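/- Let $n\ge 2$ be an integer. Let $NC_{n+1}$ be the lattice of noncrossing partitions of the vertices $1,\dots,n+1$ (in clockwise order) of a convex $(n+1)$-gon, ordered by refinement. To $\pi\in NC_{n+1}$ associate the permutation that sends each vertex $v$ to the next vertex, in clockwise order, of the block of $\pi$ containing $v$. A covering relation $\pi\lessdot\rho$ is assigned the transposition obtained by multiplying (from left to right) the permutation of $\rho$ by the inverse of the permutation of $\pi$. Stanley's bijection labels a maximal chain $\pi_0\lessdot\pi_1\lessdot\cdots\lessdot\pi_n$ of $NC_{n+1}$ by the tuple $(a_1,\dots,a_n)$ in which $a_i$ is the smaller of the two numbers interchanged by the transposition assigned to $\pi_{i-1}\lessdot\pi_i$. A tuple $(a_1,\dots,a_n)$ of positive integers is a parking function if, after sorting into weakly increasing order, its $i$-th entry is at most $i$ for every $i$. Let $PF_{n,n}$ be the set of parking functions of length $n$ in which the number $n$ does not occur (so $n$ is the largest number in $\{1,\dots,n\}$ that does not occur). Let $\mathrm{Poset}(PF_{n,n})$ be the poset whose Hasse diagram is the union of the directed paths, in the Hasse diagram of $NC_{n+1}$, given by the maximal chains labeled by elements of $PF_{n,n}$. For a bounded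 poset $P$ let $\mathrm{Link}(P)$ be the order complex of $P$ with its minimum and maximum removed; the maximal simplices of $\mathrm{Link}(NC_{n+1})$ are labeled by the labels of the corresponding maximal chains. Then $\mathrm{Link}(\mathrm{Poset}(PF_{n,n}))$ is a subcomplex of $\mathrm{Link}(NC_{n+1})$; its simplices are exactly the faces of the maximal simplices of $\mathrm{Link}(NC_{n+1})$ labeled by elements of $PF_{n,n}$; and it is contractible. -/

import Mathlib

open scoped Classical

noncomputable section

/-- Noncrossing partitions of the vertices of a convex `m`-gon labeled clockwise; the label of
`v : Fin m` is `v + 1`. A partition is given by its equivalence relation. The convex hulls of the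
blocks are pairwise disjoint iff there are no `a < b < c < d` with `a, c` in one block and `b, d`
in a different block. -/
def NCPart (m : ℕ) : Type :=
  {s : Setoid (Fin m) // ∀ a b c d : Fin m, a < b → b < c → c < d → s a c → s b d → s a b}

namespace NCPart

variable {m : ℕ}

/-- The order by refinement: `π ≤ ρ` iff every block of `π` is contained in a block of `ρ`. -/
instance : PartialOrder (NCPart m) := Subtype.partialOrder _

/-- The bottom element has only singleton blocks, the top element has a single block. -/
instance : BoundedOrder (NCPart m) where
  bot := ⟨⊥, fun a _ c _ hab hbc _ hac _ => absurd (show a = c from hac) (hab.trans hbc).ne⟩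
  bot_le π := show (⊥ : Setoid (Fin m)) ≤ π.1 from bot_le
  top := ⟨⊤, fun _ _ _ _ _ _ _ _ _ => trivial⟩
  le_top π := show π.1 ≤ (⊤ : Setoid (Fin m)) from le_top

instance : Finite (NCPart m) :=
  Finite.of_injective (fun (π : NCPart m) (x y : Fin m) => π.1 x y) fun _ _ h =>
    Subtype.ext (Setoid.ext fun x y => iff_of_eq (congrFun (congrFun h x) y))

instance : Fintype (NCPart m) := Fintype.ofFinite _

/-- The block of `v`. -/
def block (π : NCPart m) (v : Fin m) : Finset (Fin m) := Finset.univ.filter fun w => π.1 v w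

theorem mem_block (π : NCPart m) (v w : Fin m) : w ∈ π.block v ↔ π.1 v w := by simp [block]

theorem block_nonempty (π : NCPart m) (v : Fin m) : (π.block v).Nonempty :=
  ⟨v, (π.mem_block v v).2 (π.1.refl v)⟩

/-- The next vertex after `v`, in clockwise order, in the boundary cycle of the convex hull of the
block of `v`: the next larger element of the block if there is one, and otherwise its least
element. -/
def next (π : NCPart m) (v : Fin m) : Fin m :=
  if h : ((π.block v).filter fun w => v < w).Nonempty then
    ((π.block v).filter fun w => v < w).min' h
  else (π.block v).min' (π.block_nonempty v)

theorem next_mem (π : NCPart m) (v : Fin m) : π.1 v (π.next v) := by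
  unfold next
  split_ifs with h
  · exact (π.mem_block _ _).1 (Finset.mem_filter.1 (Finset.min'_mem _ h)).1
  · exact (π.mem_block _ _).1 (Finset.min'_mem _ (π.block_nonempty v))

theorem next_of_lt (π : NCPart m) {v w : Fin m} (hr : π.1 v w) (hvw : v < w) :
    v < π.next v ∧ π.next v ≤ w := by
  have hw : w ∈ (π.block v).filter fun w => v < w :=
    Finset.mem_filter.2 ⟨(π.mem_block _ _).2 hr, hvw⟩
  have h : ((π.block v).filter fun w => v < w).Nonempty := ⟨w, hw⟩
  rw [next, dif_pos h]
  exact ⟨(Finset.mem_filter.1 (Finset.min'_mem _ h)).2, Finset.min'_le _ _ hw⟩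

theorem next_le_of_le (π : NCPart m) {v w : Fin m} (hr : π.1 v w) (h : π.next v ≤ v) :
    π.next v ≤ w := by
  unfold next at h ⊢
  split_ifs at h ⊢ with h'
  · exact absurd (Finset.mem_filter.1 (Finset.min'_mem _ h')).2 (not_lt.2 h)
  · exact Finset.min'_le _ _ ((π.mem_block _ _).2 hr)

theorem next_injective (π : NCPart m) : Function.Injective π.next := by
  have key : ∀ v w : Fin m, v < w → π.next v ≠ π.next w := by
    intro v w hvw he
    have hr : π.1 v w := π.1.trans (π.next_mem v) (he ▸ π.1.symm (π.next_mem w))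
    obtain ⟨h1, h2⟩ := π.next_of_lt hr hvw
    have h3 : π.next w ≤ v := π.next_le_of_le (π.1.symm hr) (he ▸ h2)
    exact absurd (h1.trans_le (he ▸ h3)) (lt_irrefl _)
  intro v w he
  rcases lt_trichotomy v w with h | h | h
  · exact absurd he (key v w h)
  · exact h
  · exact absurd he.symm (key w v h)

/-- The noncrossing permutation of a noncrossing partition. -/
def toPerm (π : NCPart m) : Equiv.Perm (Fin m) :=
  Equiv.ofBijective π.next (Finite.injective_iff_bijective.1 π.next_injective)

end NCPart

/-- The maximal chains of the lattice of noncrossing partitions of the `(n+1)`-gon, that is, the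
directed paths from the minimum to the maximum in its Hasse diagram (all of them have `n` steps). -/
structure MaxChain (n : ℕ) where
  /-- the `i`-th element of the chain -/
  elem : Fin (n + 1) → NCPart (n + 1)
  elem_zero : elem 0 = ⊥
  elem_last : elem (Fin.last n) = ⊤
  covBy : ∀ i : Fin n, elem i.castSucc ⋖ elem i.succ

namespace MaxChain

variable {n : ℕ}

/-- The permutation assigned to the `i`-th covering relation `π ⋖ ρ` of a maximal chain: the
permutation of `ρ` multiplied by the inverse of the permutation of `π`, where products of
permutations are read from left to right (while `*` on `Equiv.Perm` is read from right to left).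
These `n` permutations are transpositions, and multiplied (with `*`) in the order of the chain
they give the cycle `(1, 2, …, n + 1)`. -/
def transposition (c : MaxChain n) (i : Fin n) : Equiv.Perm (Fin (n + 1)) :=
  (c.elem i.castSucc).toPerm⁻¹ * (c.elem i.succ).toPerm

/-- Stanley's map from maximal chains to `n`-tuples: the `i`-th entry is the smaller one of the two
labels moved by the `i`-th transposition. -/
def stanley (c : MaxChain n) (i : Fin n) : ℕ :=
  sInf {k : ℕ | ∃ v : Fin (n + 1), c.transposition i v ≠ v ∧ k = (v : ℕ) + 1}

/-- The vertex set of the maximal simplex of the noncrossing partition link given by the chain. -/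
def simplex (c : MaxChain n) : Finset (NCPart (n + 1)) :=
  Finset.univ.filter fun x => x ∈ Set.range c.elem ∧ x ≠ ⊥ ∧ x ≠ ⊤

end MaxChain

/-- The parking functions of length `n`: tuples of positive integers such that, after sorting into
weakly increasing order, the `i`-th entry is at most `i` (indices from `1`). -/
def parkingFunctions (n : ℕ) : Set (Fin n → ℕ) :=
  {a | (∀ i, 1 ≤ a i) ∧ ∀ i : Fin n, a (Tuple.sort a i) ≤ (i : ℕ) + 1}

/-- The parking functions of length `n` for which `k` is the largest element of `{1, …, n}` that is
undesired, i.e. does not occur as an entry. -/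
def parkingFunctionsUndesired (n k : ℕ) : Set (Fin n → ℕ) :=
  {a | a ∈ parkingFunctions n ∧ IsGreatest {j : ℕ | 1 ≤ j ∧ j ≤ n ∧ j ∉ Set.range a} k}

/-- `x → y` is an edge of one of the directed paths that correspond to the elements of `A`. -/
def PathEdge {n : ℕ} (A : Set (Fin n → ℕ)) (x y : NCPart (n + 1)) : Prop :=
  ∃ c : MaxChain n, c.stanley ∈ A ∧ ∃ i : Fin n, c.elem i.castSucc = x ∧ c.elem i.succ = y

/-- The elements of the poset of `A`: the vertices on the directed paths that correspond to the
elements of `A`. -/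
def PathPoset {n : ℕ} (A : Set (Fin n → ℕ)) : Type :=
  {x : NCPart (n + 1) // ∃ c : MaxChain n, c.stanley ∈ A ∧ x ∈ Set.range c.elem}

namespace PathPoset

variable {n : ℕ} {A : Set (Fin n → ℕ)}

/-- The underlying noncrossing partition. -/
def val (x : PathPoset A) : NCPart (n + 1) := Subtype.val x

theorem le_of_reflTransGen {x y : NCPart (n + 1)} (h : Relation.ReflTransGen (PathEdge A) x y) :
    x ≤ y := by
  induction h with
  | refl => exact le_rfl
  | tail _ h ih =>
    obtain ⟨c, _, i, rfl, rfl⟩ := h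
    exact ih.trans (c.covBy i).le

/-- The order whose Hasse diagram is the union of the directed paths. (In general it has fewer
relations than the order induced from the noncrossing partition lattice.) -/
instance : PartialOrder (PathPoset A) where
  le x y := Relation.ReflTransGen (PathEdge A) x.val y.val
  le_refl _ := Relation.ReflTransGen.refl
  le_trans _ _ _ h h' := h.trans h'
  le_antisymm _ _ h h' :=
    Subtype.ext (le_antisymm (le_of_reflTransGen h) (le_of_reflTransGen h'))

end PathPoset

/-- The link of a poset: the order complex of the poset with its bounding elements removed. Its
simplices are the nonempty finite chains that contain neither a minimum nor a maximum. -/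
def posetLink (P : Type*) [PartialOrder P] : PreAbstractSimplicialComplex P where
  faces := {s | s.Nonempty ∧ IsChain (· ≤ ·) (s : Set P) ∧ ∀ x ∈ s, ¬ IsBot x ∧ ¬ IsTop x}
  isRelLowerSet_faces := fun _ hs =>
    ⟨hs.1, fun _ hts ht =>
      ⟨ht, hs.2.1.mono (Finset.coe_subset.2 hts), fun x hx => hs.2.2 x (hts hx)⟩⟩

/-- The link of the poset of `A`, as a complex on noncrossing partitions. -/
def pathLink {n : ℕ} (A : Set (Fin n → ℕ)) : PreAbstractSimplicialComplex (NCPart (n + 1)) :=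
  (posetLink (PathPoset A)).map PathPoset.val

/-- The geometric realization of a simplicial complex on a finite set of vertices, in barycentric
coordinates. -/
def geomRealization {V : Type*} [Fintype V] (K : PreAbstractSimplicialComplex V) : Set (V → ℝ) :=
  {x | x ∈ stdSimplex ℝ V ∧ ∃ s ∈ K.faces, ∀ v, x v ≠ 0 → v ∈ s}

end

/-! Call a noncrossing partition isolated if the last vertex is a singleton block, joined if the
last two vertices share a block, and skipping otherwise. Isolated partitions form a down-set
containing `⊥`, joined ones an up-set containing `⊤`, and the two are disjoint. A covering step has
label `n` exactly when it jumps from isolated to joined (`stanley_eq_iff`). Every label tuple is a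
parking function (`stanley_mem_parkingFunctions`), so the chains labeled by the given set are those
passing through a skipping partition.

Write `SkipLE x y` if `x ≤ y` and, when `x` is isolated and `y` joined, a skipping partition lies
between them. This is a partial order. In a `SkipLE`-chain there is room for a skipping element
between the largest isolated and the smallest joined member (`exists_lastSkips_of_skipLE`), so the
chain lies on one admissible maximal chain. The link is therefore the complex of `SkipLE`-chains in
`skipProper n`, and its simplices are the asserted faces.

For contractibility, let `t` be joined and let `m` be the least vertex in the block of its last
vertex. Merging the last vertex with `m` gives, for each non-joined `z` below `t`, the join of `z`
with one fixed skipping partition (`exists_join_lastSkips`). Having such a join point makes a poset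
contractible. Thus every joined element can be deleted without changing the homotopy type, and the
case `t = ⊤` contracts what remains. -/

noncomputable section

/-! ### Collapsing complexes of chains -/

section Collapse

variable {V : Type*}

/-- The subcomplex of the simplices that have no face in `D`. -/
def PreAbstractSimplicialComplex.avoid (K : PreAbstractSimplicialComplex V)
    (D : Set (Finset V)) : PreAbstractSimplicialComplex V where
  faces := {τ | τ ∈ K.faces ∧ ∀ σ ∈ D, ¬ σ ⊆ τ}
  isRelLowerSet_faces := fun _ hs =>
    ⟨(K.isRelLowerSet_faces hs.1).1, fun _ hts ht =>
      ⟨(K.isRelLowerSet_faces hs.1).2 hts ht, fun σ hσ h => hs.2 σ hσ (h.trans hts)⟩⟩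

theorem PreAbstractSimplicialComplex.mem_avoid {K : PreAbstractSimplicialComplex V}
    {D : Set (Finset V)} {τ : Finset V} :
    τ ∈ (K.avoid D).faces ↔ τ ∈ K.faces ∧ ∀ σ ∈ D, ¬ σ ⊆ τ := Iff.rfl

theorem PreAbstractSimplicialComplex.ext_faces {K L : PreAbstractSimplicialComplex V}
    (h : ∀ τ, τ ∈ K.faces ↔ τ ∈ L.faces) : K = L := by
  cases K; cases L; congr; exact Set.ext h

theorem PreAbstractSimplicialComplex.avoid_insert (K : PreAbstractSimplicialComplex V)
    (σ : Finset V) (D : Set (Finset V)) : K.avoid (insert σ D) = (K.avoid {σ}).avoid D :=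
  ext_faces fun τ => by simp [mem_avoid, and_assoc]

/-- The map that pushes the points of the star of the simplex `σ` off `σ`, towards `v`. -/
def pushOff (σ : Finset V) (hσ : σ.Nonempty) (v : V) (x : V → ℝ) : V → ℝ :=
  fun w => x w - (if w ∈ σ then σ.inf' hσ x else 0) + if w = v then σ.card * σ.inf' hσ x else 0

theorem continuous_pushOff (σ : Finset V) (hσ : σ.Nonempty) (v : V) :
    Continuous (pushOff σ hσ v) := by
  have h : Continuous fun x : V → ℝ => σ.inf' hσ x :=
    Continuous.finset_inf'_apply hσ fun i _ => continuous_apply i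
  refine continuous_pi fun w => ?_
  unfold pushOff
  split_ifs <;> fun_prop

theorem pushOff_eq_self {σ : Finset V} (hσ : σ.Nonempty) (v : V) {x : V → ℝ}
    (hx : σ.inf' hσ x = 0) : pushOff σ hσ v x = x := by
  funext w
  simp [pushOff, hx]

theorem inf'_eq_zero {σ : Finset V} (hσ : σ.Nonempty) {x : V → ℝ} (hx : ∀ v, 0 ≤ x v) {u : V}
    (hu : u ∈ σ) (h0 : x u = 0) : σ.inf' hσ x = 0 :=
  le_antisymm (h0 ▸ Finset.inf'_le _ hu) (Finset.le_inf' hσ _ fun i _ => hx i)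

section Chains

variable [PartialOrder V]

/-- The complex of the nonempty finite chains in `A`. -/
def chainComplex (A : Set V) : PreAbstractSimplicialComplex V where
  faces := {s | s.Nonempty ∧ (s : Set V) ⊆ A ∧ IsChain (· ≤ ·) (s : Set V)}
  isRelLowerSet_faces := fun _ hs =>
    ⟨hs.1, fun _ hts ht => ⟨ht, (Finset.coe_subset.2 hts).trans hs.2.1,
      hs.2.2.mono (Finset.coe_subset.2 hts)⟩⟩

/-- `L` has an element `e` that has a join in `L` with every element of `L`. -/
def HasJoinPoint (L : Set V) : Prop :=
  ∃ e ∈ L, ∀ z ∈ L, ∃ j ∈ L, z ≤ j ∧ e ≤ j ∧ ∀ w ∈ L, z ≤ w → e ≤ w → j ≤ w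

theorem insert_mem_chainComplex {A : Set V} {j : V} (hj : j ∈ A) {τ : Finset V}
    (hτ : τ ∈ (chainComplex A).faces) (h : ∀ w ∈ τ, j ≤ w ∨ w ≤ j) :
    insert j τ ∈ (chainComplex A).faces := by
  refine ⟨Finset.insert_nonempty _ _, ?_, ?_⟩
  · rw [Finset.coe_insert]
    exact Set.insert_subset hj hτ.2.1
  · rw [Finset.coe_insert]
    exact hτ.2.2.insert fun w hw _ => h w hw

theorem comparable_of_mem {A : Set V} {τ : Finset V} (hτ : τ ∈ (chainComplex A).faces) {x y : V}
    (hx : x ∈ τ) (hy : y ∈ τ) : x ≤ y ∨ y ≤ x := hτ.2.2.total hx hy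

end Chains

variable [Fintype V]

theorem geomRealization_mono {K L : PreAbstractSimplicialComplex V} (h : K.faces ⊆ L.faces) :
    geomRealization K ⊆ geomRealization L :=
  fun _ hx => ⟨hx.1, hx.2.imp fun _ hs => ⟨h hs.1, hs.2⟩⟩

theorem mem_geomRealization_iff {K : PreAbstractSimplicialComplex V} {x : V → ℝ} :
    x ∈ geomRealization K ↔
      x ∈ stdSimplex ℝ V ∧ (Finset.univ.filter fun v => x v ≠ 0) ∈ K.faces := by
  constructor
  · rintro ⟨hx, s, hs, h⟩
    refine ⟨hx, (K.isRelLowerSet_faces hs).2 (fun v hv => h v (by simpa using hv)) ?_⟩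
    by_contra hne
    have h0 : ∀ v, x v = 0 := fun v => by
      by_contra hv
      exact hne ⟨v, by simpa using hv⟩
    have := hx.2
    simp [h0] at this
  · rintro ⟨hx, h⟩
    exact ⟨hx, _, h, fun v hv => by simpa using hv⟩

/-- The realization is star-shaped about the vertex `e`. -/
theorem contractibleSpace_of_cone {K : PreAbstractSimplicialComplex V} {e : V}
    (he : {e} ∈ K.faces) (h : ∀ τ ∈ K.faces, insert e τ ∈ K.faces) :
    ContractibleSpace (geomRealization K) := by
  have hmem : Pi.single e (1 : ℝ) ∈ geomRealization K :=
    ⟨single_mem_stdSimplex ℝ e, {e}, he, fun v hv => by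
      by_contra hne
      exact hv (Pi.single_eq_of_ne (by simpa using hne) _)⟩
  refine StarConvex.contractibleSpace (x := Pi.single e (1 : ℝ)) ?_ ⟨_, hmem⟩
  rintro y ⟨hy, s, hs, hys⟩ a b ha hb hab
  refine ⟨convex_stdSimplex ℝ V hmem.1 hy ha hb hab, insert e s, h s hs, fun v hv => ?_⟩
  by_contra hne
  rw [Finset.mem_insert, not_or] at hne
  refine hv ?_
  have h1 : y v = 0 := by by_contra h0; exact hne.2 (hys v h0)
  simp [h1, Pi.single_eq_of_ne hne.1]

/-- The minimum over `σ` is taken from each of the `σ.card` coordinates, and the same total is given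
to `v`. -/
theorem pushOff_mem_stdSimplex {σ : Finset V} (hσ : σ.Nonempty) (v : V) {x : V → ℝ}
    (hx : x ∈ stdSimplex ℝ V) : pushOff σ hσ v x ∈ stdSimplex ℝ V := by
  have hc : 0 ≤ σ.inf' hσ x := Finset.le_inf' hσ _ fun i _ => hx.1 i
  refine ⟨fun w => ?_, ?_⟩
  · have h1 : 0 ≤ x w - (if w ∈ σ then σ.inf' hσ x else 0) := by
      split_ifs with h
      · exact sub_nonneg.2 (Finset.inf'_le _ h)
      · simpa using hx.1 w
    have h2 : 0 ≤ if w = v then σ.card * σ.inf' hσ x else 0 := by split_ifs <;> positivity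
    exact add_nonneg h1 h2
  · simp only [pushOff, Finset.sum_add_distrib, Finset.sum_sub_distrib, hx.2]
    simp

/-- If the link of the simplex `σ` is a cone, then the open star of `σ` can be removed. -/
theorem contractibleSpace_of_avoid {K : PreAbstractSimplicialComplex V} {σ : Finset V}
    (hσ : σ.Nonempty) {v : V} (hv : v ∉ σ)
    (h : ∀ τ ∈ K.faces, σ ⊆ τ → insert v τ ∈ K.faces)
    (hK : ContractibleSpace (geomRealization (K.avoid {σ}))) :
    ContractibleSpace (geomRealization K) := by
  have hsub : geomRealization (K.avoid {σ}) ⊆ geomRealization K :=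
    geomRealization_mono fun _ hs => hs.1
  have key : ∀ x ∈ geomRealization K, pushOff σ hσ v x ∈ geomRealization (K.avoid {σ}) ∧
      ∃ s ∈ K.faces, (∀ w, x w ≠ 0 → w ∈ s) ∧ ∀ w, pushOff σ hσ v x w ≠ 0 → w ∈ s := by
    intro x hx
    obtain ⟨hx1, hx2⟩ := mem_geomRealization_iff.1 hx
    -- If the minimum is zero, the support does not contain `σ` and the point stays put. Otherwise
    -- the support is a simplex containing `σ`, and adding `v` gives a simplex that carries both the
    -- point and its image.
    by_cases hc : σ.inf' hσ x = 0
    · rw [pushOff_eq_self hσ v hc]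
      refine ⟨⟨hx1, _, ⟨hx2, ?_⟩, fun w hw => by simpa using hw⟩, _, hx2,
        fun w hw => by simpa using hw, fun w hw => by simpa using hw⟩
      rintro _ rfl hs
      obtain ⟨u, hu, hu'⟩ := Finset.exists_mem_eq_inf' hσ x
      have := hs hu
      rw [Finset.mem_filter] at this
      exact this.2 (hu' ▸ hc)
    · have hs : σ ⊆ Finset.univ.filter fun v => x v ≠ 0 := fun u hu => by
        rw [Finset.mem_filter]
        exact ⟨Finset.mem_univ _, fun h0 => hc (inf'_eq_zero hσ hx1.1 hu h0)⟩
      have hf := h _ hx2 hs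
      have hsupp : ∀ w, pushOff σ hσ v x w ≠ 0 →
          w ∈ insert v (Finset.univ.filter fun v => x v ≠ 0) := by
        intro w hw
        by_contra hne
        rw [Finset.mem_insert, not_or] at hne
        have h1 : w ∉ σ := fun hw' => hne.2 (hs hw')
        have h2 : x w = 0 := by simpa using hne.2
        exact hw (by simp [pushOff, h1, h2, hne.1])
      have hmem : pushOff σ hσ v x ∈ geomRealization K :=
        ⟨pushOff_mem_stdSimplex hσ v hx1, _, hf, hsupp⟩
      refine ⟨mem_geomRealization_iff.2 ⟨hmem.1, (mem_geomRealization_iff.1 hmem).2, ?_⟩,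
        _, hf, fun w hw => Finset.mem_insert_of_mem (by simpa using hw), hsupp⟩
      -- A coordinate of `σ` attaining the minimum becomes zero; it is not refilled because `v ∉ σ`.
      rintro _ rfl hs'
      obtain ⟨u, hu, hu'⟩ := Finset.exists_mem_eq_inf' hσ x
      have := hs' hu
      rw [Finset.mem_filter] at this
      refine this.2 ?_
      have huv : u ≠ v := fun h => hv (h ▸ hu)
      simp [pushOff, hu, huv, hu']
  let r : C(geomRealization K, geomRealization (K.avoid {σ})) :=
    ⟨fun x => ⟨pushOff σ hσ v x, (key x x.2).1⟩,
      ((continuous_pushOff σ hσ v).comp continuous_subtype_val).subtype_mk _⟩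
  let i : C(geomRealization (K.avoid {σ}), geomRealization K) :=
    ⟨Set.inclusion hsub, continuous_inclusion hsub⟩
  have hri : r.comp i = ContinuousMap.id _ := by
    ext1 x
    refine Subtype.ext (pushOff_eq_self hσ v ?_)
    obtain ⟨hx1, hx2⟩ := mem_geomRealization_iff.1 x.2
    have := hx2.2 σ rfl
    obtain ⟨u, hu, hu'⟩ := Finset.not_subset.1 this
    exact inf'_eq_zero hσ hx1.1 hu (by_contra fun h0 => hu' (Finset.mem_filter.2 ⟨Finset.mem_univ _, h0⟩))
  -- The straight segment from the pushed point to the original one stays in their common simplex.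
  have hir : (i.comp r).Homotopic (ContinuousMap.id _) := by
    refine ⟨⟨⟨fun p => ⟨(1 - (p.1 : ℝ)) • pushOff σ hσ v p.2 + (p.1 : ℝ) • (p.2 : V → ℝ), ?_⟩,
      ?_⟩, ?_, ?_⟩⟩
    · obtain ⟨h1, s, hs, hs1, hs2⟩ := key p.2 p.2.2
      refine ⟨convex_stdSimplex ℝ V h1.1 p.2.2.1 (sub_nonneg.2 p.1.2.2) p.1.2.1 (by ring), s, hs,
        fun w hw => ?_⟩
      by_contra hne
      have e1 : (p.2 : V → ℝ) w = 0 := by by_contra h0; exact hne (hs1 w h0)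
      have e2 : pushOff σ hσ v p.2 w = 0 := by by_contra h0; exact hne (hs2 w h0)
      exact hw (by simp [e1, e2])
    · have := continuous_pushOff σ hσ v
      refine Continuous.subtype_mk ?_ _
      fun_prop
    · intro x
      exact Subtype.ext (by simp [i, r])
    · intro x
      exact Subtype.ext (by simp)
  exact ContinuousMap.HomotopyEquiv.contractibleSpace
    ⟨r, i, hir, hri ▸ ContinuousMap.Homotopic.refl _⟩

variable [PartialOrder V]

/-- Removal of the open stars of the simplices `insert z ρ`, `z ∈ Z`, from the largest to the
smallest `z`. -/
theorem contractibleSpace_of_avoid_image (ρ : Finset V) (j : V → V) (Z : Finset V) :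
    ∀ K : PreAbstractSimplicialComplex V,
      (∀ z ∈ Z, j z ∉ Z ∧ j z ∉ ρ ∧ ∀ τ ∈ K.faces, insert z ρ ⊆ τ →
        (∀ w ∈ τ, w ∈ Z → ¬ z < w) → insert (j z) τ ∈ K.faces) →
      ContractibleSpace (geomRealization (K.avoid ((fun z => insert z ρ) '' Z))) →
      ContractibleSpace (geomRealization K) := by
  induction Z using Finset.strongInduction with
  | H Z ih =>
    intro K h hK
    rcases Z.eq_empty_or_nonempty with rfl | hne
    · have : K.avoid ((fun z => insert z ρ) '' ((∅ : Finset V) : Set V)) = K :=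
        PreAbstractSimplicialComplex.ext_faces fun τ => by
          simp [PreAbstractSimplicialComplex.mem_avoid]
      rwa [this] at hK
    obtain ⟨z, hz⟩ := Z.exists_maximal hne
    obtain ⟨h1, h2, h3⟩ := h z hz.prop
    refine contractibleSpace_of_avoid (Finset.insert_nonempty z ρ) (v := j z) ?_
      (fun τ hτ hs => h3 τ hτ hs fun w _ hwZ hlt => hz.not_gt hwZ hlt) ?_
    · rw [Finset.mem_insert, not_or]
      exact ⟨fun e => h1 (e.symm ▸ hz.prop), h2⟩
    refine ih (Z.erase z) (Finset.erase_ssubset hz.prop) _ ?_ ?_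
    · intro z' hz'
      obtain ⟨hne', hz'⟩ := Finset.mem_erase.1 hz'
      obtain ⟨g1, g2, g3⟩ := h z' hz'
      refine ⟨fun hh => g1 (Finset.mem_of_mem_erase hh), g2, fun τ hτ hs hmax => ?_⟩
      have hzτ : z ∉ τ := fun hzτ => hτ.2 _ rfl (Finset.insert_subset hzτ
        ((Finset.subset_insert _ _).trans hs))
      refine ⟨g3 τ hτ.1 hs fun w hw hwZ => hmax w hw (Finset.mem_erase.2 ⟨?_, hwZ⟩), ?_⟩
      · rintro rfl
        exact hzτ hw
      -- Adding `j z'` cannot recreate the removed simplex `insert z ρ`, because `j z'` lies outside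
      -- `Z` and so differs from `z`.
      · rintro _ rfl hs'
        rcases Finset.mem_insert.1 (hs' (Finset.mem_insert_self z ρ)) with e | e
        · exact g1 (e ▸ hz.prop)
        · exact hzτ e
    · have hi := Set.image_insert_eq (f := fun z => insert z ρ) (a := z) (s := (Z.erase z : Set V))
      rw [← Finset.coe_insert, Finset.insert_erase hz.prop] at hi
      rwa [← PreAbstractSimplicialComplex.avoid_insert, ← hi]

/-- Delete the elements `z` not above `e`, from the top down. When `z` is deleted, everything
remaining above it is also above `e`, hence above the join of `z` and `e`, so that join is an apex
for the star of `z`. What is left is a cone with apex `e`. -/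
theorem HasJoinPoint.contractibleSpace {A : Set V} (h : HasJoinPoint A) :
    ContractibleSpace (geomRealization (chainComplex A)) := by
  obtain ⟨e, he, h⟩ := h
  choose! j hjA hzj hej hjw using h
  refine contractibleSpace_of_avoid_image ∅ j (Finset.univ.filter fun z => z ∈ A ∧ ¬ e ≤ z) _ ?_ ?_
  · intro z hz
    obtain ⟨-, hzA, hez⟩ := Finset.mem_filter.1 hz
    refine ⟨fun hh => (Finset.mem_filter.1 hh).2.2 (hej z hzA), Finset.notMem_empty _,
      fun τ hτ hs hmax => insert_mem_chainComplex (hjA z hzA) hτ fun w hw => ?_⟩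
    have hzτ : z ∈ τ := hs (Finset.mem_insert_self _ _)
    rcases comparable_of_mem hτ hw hzτ with hwz | hzw
    · exact Or.inr (hwz.trans (hzj z hzA))
    · rcases hzw.eq_or_lt with rfl | hlt
      · exact Or.inr (hzj z hzA)
      · have := hmax w hw
        have hwA := hτ.2.1 hw
        refine Or.inl (hjw z hzA w hwA hzw ?_)
        by_contra hew
        exact this (Finset.mem_filter.2 ⟨Finset.mem_univ _, hwA, hew⟩) hlt
  · refine contractibleSpace_of_cone (e := e) ⟨⟨by simp, by simpa using he, by simp⟩, ?_⟩ ?_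
    · rintro _ ⟨z, hz, rfl⟩ hs
      have hz' := (Finset.mem_filter.1 (Finset.mem_coe.1 hz)).2.2
      have := hs (Finset.mem_insert_self _ _)
      rw [Finset.mem_singleton] at this
      exact hz' this.ge
    · intro τ hτ
      have hle : ∀ w ∈ τ, e ≤ w := fun w hw => by
        by_contra hew
        exact hτ.2 _ ⟨w, Finset.mem_coe.2 (Finset.mem_filter.2
          ⟨Finset.mem_univ _, hτ.1.2.1 hw, hew⟩), rfl⟩ (by simpa using hw)
      refine ⟨insert_mem_chainComplex he hτ.1 fun w hw => Or.inl (hle w hw), ?_⟩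
      rintro _ ⟨z, hz, rfl⟩ hs
      have hz' := (Finset.mem_filter.1 (Finset.mem_coe.1 hz)).2.2
      rcases Finset.mem_insert.1 (hs (Finset.mem_insert_self _ _)) with rfl | hw
      · exact hz' le_rfl
      · exact hz' (hle z hw)

/-- The argument for a join point `e` is run inside the star of `t`: the edges `{z, t}` with `z < t`
not above `e` go first, and then `t` itself, whose remaining link is a cone with apex `e`. Elements
above `t` are above `e` and all the joins anyway. -/
theorem contractibleSpace_of_remove_point {B : Set V} {t : V}
    (hL : HasJoinPoint {z | z ∈ B ∧ z < t})
    (hB : ContractibleSpace (geomRealization (chainComplex (B \ {t})))) :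
    ContractibleSpace (geomRealization (chainComplex B)) := by
  obtain ⟨e, ⟨heB, het⟩, h⟩ := hL
  choose! j hjL hzj hej hjw using h
  refine contractibleSpace_of_avoid_image {t} j
    (Finset.univ.filter fun z => (z ∈ B ∧ z < t) ∧ ¬ e ≤ z) _ ?_ ?_
  · intro z hz
    obtain ⟨-, hzL, hez⟩ := Finset.mem_filter.1 hz
    refine ⟨fun hh => (Finset.mem_filter.1 hh).2.2 (hej z hzL), fun hh => ?_,
      fun τ hτ hs hmax => insert_mem_chainComplex (hjL z hzL).1 hτ fun w hw => ?_⟩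
    · rw [Finset.mem_singleton] at hh
      exact (hjL z hzL).2.ne hh
    have hzτ : z ∈ τ := hs (Finset.mem_insert_self _ _)
    have htτ : t ∈ τ := hs (by simp)
    rcases comparable_of_mem hτ hw hzτ with hwz | hzw
    · exact Or.inr (hwz.trans (hzj z hzL))
    rcases hzw.eq_or_lt with rfl | hlt
    · exact Or.inr (hzj z hzL)
    by_cases hwt : t ≤ w
    · exact Or.inl ((hjL z hzL).2.le.trans hwt)
    have hwt' : w < t := lt_of_le_not_ge ((comparable_of_mem hτ hw htτ).resolve_right hwt) hwt
    have hwL : w ∈ B ∧ w < t := ⟨hτ.2.1 hw, hwt'⟩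
    refine Or.inl (hjw z hzL w hwL hzw ?_)
    by_contra hew
    exact hmax w hw (Finset.mem_filter.2 ⟨Finset.mem_univ _, hwL, hew⟩) hlt
  · refine contractibleSpace_of_avoid (Finset.singleton_nonempty t) (v := e)
      (by simpa using het.ne) ?_ ?_
    · intro τ hτ hs
      have htτ : t ∈ τ := hs (by simp)
      refine ⟨insert_mem_chainComplex heB hτ.1 fun w hw => Or.inl ?_, ?_⟩
      · by_cases hwt : t ≤ w
        · exact het.le.trans hwt
        have hwt' : w < t :=
          lt_of_le_not_ge ((comparable_of_mem hτ.1 hw htτ).resolve_right hwt) hwt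
        by_contra hew
        refine hτ.2 _ ⟨w, Finset.mem_coe.2 (Finset.mem_filter.2
          ⟨Finset.mem_univ _, ⟨hτ.1.2.1 hw, hwt'⟩, hew⟩), rfl⟩ ?_
        exact Finset.insert_subset hw hs
      · rintro _ ⟨z, hz, rfl⟩ hs'
        have hz' := (Finset.mem_filter.1 (Finset.mem_coe.1 hz)).2.2
        rcases Finset.mem_insert.1 (hs' (Finset.mem_insert_self _ _)) with rfl | hw
        · exact hz' le_rfl
        · exact hτ.2 _ ⟨z, hz, rfl⟩ (Finset.insert_subset hw hs)
    · refine (congrArg (fun K => ContractibleSpace (geomRealization K))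
        (PreAbstractSimplicialComplex.ext_faces fun τ => ?_)).mpr hB
      refine ⟨fun hτ => ?_, fun hτ => ?_⟩
      · exact ⟨hτ.1.1.1, fun w hw => ⟨hτ.1.1.2.1 hw, fun hwt => hτ.2 _ rfl (by
          rw [Set.mem_singleton_iff] at hwt
          simpa [← hwt] using hw)⟩, hτ.1.1.2.2⟩
      · have htτ : t ∉ τ := fun htτ => (hτ.2.1 htτ).2 rfl
        refine ⟨⟨⟨hτ.1, fun w hw => (hτ.2.1 hw).1, hτ.2.2⟩, ?_⟩, ?_⟩
        · rintro _ ⟨z, hz, rfl⟩ hs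
          exact htτ (hs (by simp))
        · rintro _ rfl hs
          exact htτ (hs (by simp))

/-- The complex of `A` has the homotopy type of that of `A \ T` when, for all `t ∈ A ∩ T`,
the elements of `A \ T` below `t` form a set with a join point. -/
theorem contractibleSpace_chainComplex {A T : Set V}
    (h0 : HasJoinPoint (A \ T))
    (h : ∀ t ∈ A ∩ T, HasJoinPoint {z | z ∈ A \ T ∧ z ≤ t}) :
    ContractibleSpace (geomRealization (chainComplex A)) := by
  have key : ∀ U : Finset V, (U : Set V) ⊆ A ∩ T →
      ContractibleSpace (geomRealization (chainComplex (A \ T ∪ U))) := by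
    intro U
    induction U using Finset.strongInduction with
    | H U ih =>
      intro hU
      rcases U.eq_empty_or_nonempty with rfl | hne
      · rw [Finset.coe_empty, Set.union_empty]
        exact h0.contractibleSpace
      -- By minimality no other element of `U` is below `t`, so the part below `t` is exactly the
      -- set in the hypothesis.
      obtain ⟨t, ht⟩ := U.exists_minimal hne
      refine contractibleSpace_of_remove_point (t := t) ?_ ?_
      · convert h t (hU ht.prop) using 1
        ext z
        constructor
        · rintro ⟨hz | hz, hlt⟩
          · exact ⟨hz, hlt.le⟩
          · exact absurd hlt (ht.not_lt hz)
        · rintro ⟨hz, hle⟩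
          refine ⟨Or.inl hz, lt_of_le_of_ne hle ?_⟩
          rintro rfl
          exact hz.2 (hU ht.prop).2
      · have := ih (U.erase t) (Finset.erase_ssubset ht.prop)
          ((Finset.coe_subset.2 (Finset.erase_subset _ _)).trans hU)
        refine (congrArg (fun B => ContractibleSpace (geomRealization (chainComplex B)))
          (Set.ext fun z => ?_)).mpr this
        have : t ∉ A \ T := fun hh => hh.2 (hU ht.prop).2
        simp only [Finset.coe_erase, Set.mem_sdiff, Set.mem_union, Set.mem_singleton_iff]
        constructor
        · rintro ⟨h1 | h1, h2⟩
          · exact Or.inl h1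
          · exact Or.inr ⟨h1, h2⟩
        · rintro (h1 | h1)
          · exact ⟨Or.inl h1, fun e => this (e ▸ h1)⟩
          · exact ⟨Or.inr h1.1, h1.2⟩
  refine (congrArg (fun B => ContractibleSpace (geomRealization (chainComplex B)))
    (Set.ext fun v => ?_)).mpr
    (key (Finset.univ.filter fun v => v ∈ A ∩ T) (fun v hv => by simpa using hv))
  by_cases hv : v ∈ T <;> simp

end Collapse

/-! ### Noncrossing partitions: rank and merging -/

namespace NCPart

variable {m : ℕ}

theorem le_iff {π ρ : NCPart m} : π ≤ ρ ↔ ∀ x y, π.1 x y → ρ.1 x y :=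
  ⟨fun h x y => @h x y, fun h x y => h x y⟩

theorem bot_rel {x y : Fin m} : (⊥ : NCPart m).1 x y ↔ x = y := Iff.rfl

theorem noncrossing (π : NCPart m) {a b c d : Fin m} (hab : a < b) (hbc : b < c) (hcd : c < d)
    (hac : π.1 a c) (hbd : π.1 b d) : π.1 a b := π.2 a b c d hab hbc hcd hac hbd

/-! ### Counting blocks -/

/-- The vertices `v ≥ k` that are the least ones of their block among the vertices `≥ k`. -/
def mins (π : NCPart m) (k : ℕ) : Finset (Fin m) :=
  Finset.univ.filter fun v => k ≤ (v : ℕ) ∧ ∀ w : Fin m, k ≤ (w : ℕ) → π.1 v w → v ≤ w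

theorem mem_mins {π : NCPart m} {k : ℕ} {v : Fin m} :
    v ∈ π.mins k ↔ k ≤ (v : ℕ) ∧ ∀ w : Fin m, k ≤ (w : ℕ) → π.1 v w → v ≤ w := by simp [mins]

theorem mins_subset {π ρ : NCPart m} (h : π ≤ ρ) (k : ℕ) : ρ.mins k ⊆ π.mins k := fun v hv => by
  rw [mem_mins] at hv ⊢
  exact ⟨hv.1, fun w hw hvw => hv.2 w hw (le_iff.1 h _ _ hvw)⟩

theorem exists_mem_mins (π : NCPart m) {k : ℕ} {v : Fin m} (hv : k ≤ (v : ℕ)) :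
    ∃ u ∈ π.mins k, π.1 v u := by
  have hne : (Finset.univ.filter fun w : Fin m => k ≤ (w : ℕ) ∧ π.1 v w).Nonempty :=
    ⟨v, Finset.mem_filter.2 ⟨Finset.mem_univ _, hv, π.1.refl v⟩⟩
  obtain ⟨u, hu⟩ := Finset.exists_minimal hne
  have h1 := (Finset.mem_filter.1 hu.prop).2
  refine ⟨u, mem_mins.2 ⟨h1.1, fun w hw huw => ?_⟩, h1.2⟩
  have hmem : w ∈ Finset.univ.filter fun w : Fin m => k ≤ (w : ℕ) ∧ π.1 v w := by
    simpa using ⟨hw, π.1.trans h1.2 huw⟩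
  exact not_lt.1 (hu.not_lt hmem)

/-- The blocks of `x` and `y`, cut down to the vertices `≥ k`, have different minima in `π`; the
larger one is no longer a minimum in `ρ`. -/
theorem mins_ssubset {π ρ : NCPart m} (h : π ≤ ρ) {k : ℕ} {x y : Fin m} (hx : k ≤ (x : ℕ))
    (hy : k ≤ (y : ℕ)) (hρ : ρ.1 x y) (hπ : ¬ π.1 x y) : ρ.mins k ⊂ π.mins k := by
  obtain ⟨u, hu, hxu⟩ := π.exists_mem_mins hx
  obtain ⟨v, hv, hyv⟩ := π.exists_mem_mins hy
  have huv : u ≠ v := by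
    rintro rfl
    exact hπ (π.1.trans hxu (π.1.symm hyv))
  have hr : ρ.1 u v := ρ.1.trans (ρ.1.symm (le_iff.1 h _ _ hxu))
    (ρ.1.trans hρ (le_iff.1 h _ _ hyv))
  refine (Finset.ssubset_iff_of_subset (mins_subset h k)).2 ?_
  rcases huv.lt_or_gt with hlt | hlt
  · exact ⟨v, hv, fun hh => absurd ((mem_mins.1 hh).2 u (mem_mins.1 hu).1 (ρ.1.symm hr))
      (not_le.2 hlt)⟩
  · exact ⟨u, hu, fun hh => absurd ((mem_mins.1 hh).2 v (mem_mins.1 hv).1 hr) (not_le.2 hlt)⟩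

theorem card_mins_bot (k : ℕ) : ((⊥ : NCPart m).mins k).card = m - k := by
  have : (⊥ : NCPart m).mins k = Finset.univ.filter fun v : Fin m => k ≤ (v : ℕ) := by
    ext v
    simp only [mem_mins, Finset.mem_filter, Finset.mem_univ, true_and, bot_rel, and_iff_left_iff_imp]
    rintro _ w _ rfl
    exact le_rfl
  rw [this]
  have h := Fin.card_filter_val_lt (n := m) (m := k)
  have h2 := Finset.card_filter_add_card_filter_not (s := (Finset.univ : Finset (Fin m)))
    (fun v : Fin m => (v : ℕ) < k)
  simp only [not_lt, Finset.card_univ, Fintype.card_fin] at h2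
  omega

theorem card_mins_pos (π : NCPart m) {k : ℕ} (hk : k < m) : 0 < (π.mins k).card :=
  let ⟨u, hu, _⟩ := π.exists_mem_mins (v := ⟨k, hk⟩) le_rfl
  Finset.card_pos.2 ⟨u, hu⟩

theorem card_mins_top (hm : 0 < m) : ((⊤ : NCPart m).mins 0).card = 1 := by
  refine le_antisymm (Finset.card_le_one.2 fun a ha b hb => ?_) (card_mins_pos _ hm)
  exact le_antisymm ((mem_mins.1 ha).2 b (Nat.zero_le _) trivial)
    ((mem_mins.1 hb).2 a (Nat.zero_le _) trivial)

theorem exists_rel_of_lt {π ρ : NCPart m} (h : π < ρ) : ∃ x y, x < y ∧ ρ.1 x y ∧ ¬ π.1 x y := by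
  by_contra hne
  push Not at hne
  refine h.not_ge (le_iff.2 fun x y hxy => ?_)
  rcases lt_trichotomy x y with hlt | rfl | hlt
  · exact hne x y hlt hxy
  · exact π.1.refl _
  · exact π.1.symm (hne y x hlt (ρ.1.symm hxy))

theorem mins_zero_ssubset {π ρ : NCPart m} (h : π < ρ) : ρ.mins 0 ⊂ π.mins 0 := by
  obtain ⟨x, y, -, hρ, hπ⟩ := exists_rel_of_lt h
  exact mins_ssubset h.le (Nat.zero_le _) (Nat.zero_le _) hρ hπ

/-! ### Merging two blocks -/

/-- The equivalence relation obtained by merging the blocks of `a` and `b`. -/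
def mergeSetoid (s : Setoid (Fin m)) (a b : Fin m) : Setoid (Fin m) where
  r x y := s x y ∨ (s x a ∨ s x b) ∧ (s y a ∨ s y b)
  iseqv :=
    { refl := fun x => Or.inl (s.refl x)
      symm := fun {x y} h => h.elim (fun h => Or.inl (s.symm h)) fun h => Or.inr h.symm
      trans := fun {x y z} h h' => by
        rcases h with h | h <;> rcases h' with h' | h'
        · exact Or.inl (s.trans h h')
        · exact Or.inr ⟨h'.1.imp (s.trans h) (s.trans h), h'.2⟩
        · exact Or.inr ⟨h.1, h.2.imp (s.trans (s.symm h')) (s.trans (s.symm h'))⟩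
        · exact Or.inr ⟨h.1, h'.2⟩ }

/-- The blocks of `a` and `b` can be merged when no other block separates `a` from `b`. -/
def Mergeable (π : NCPart m) (a b : Fin m) : Prop :=
  ∀ p q, π.1 p q → ¬ π.1 p a → ¬ π.1 p b → p < q → (p < a ∧ a < q ↔ p < b ∧ b < q)

theorem Mergeable.between {π : NCPart m} {a b : Fin m} (h : Mergeable π a b) {p q x : Fin m}
    (hpq : π.1 p q) (hpa : ¬ π.1 p a) (hpb : ¬ π.1 p b) (hlt : p < q) (hx : π.1 x a ∨ π.1 x b) :
    p < x ∧ x < q ↔ p < a ∧ a < q := by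
  -- A block not containing `p` and `q` lies entirely on one side of the chord `pq`.
  have key : ∀ c, ¬ π.1 p c → π.1 x c → (p < x ∧ x < q ↔ p < c ∧ c < q) := by
    intro c hpc hxc
    have hpx : ¬ π.1 p x := fun hh => hpc (π.1.trans hh hxc)
    have hne : ∀ y, π.1 x y → y ≠ p ∧ y ≠ q := fun y hy =>
      ⟨fun e => hpx (e ▸ π.1.symm hy), fun e => hpx (π.1.trans hpq (e ▸ π.1.symm hy))⟩
    have hdir : ∀ y z, π.1 x y → π.1 x z → p < y ∧ y < q → p < z ∧ z < q := by
      rintro y z hy hz ⟨h1, h2⟩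
      have hyz := π.1.trans (π.1.symm hy) hz
      constructor
      · by_contra hh
        have hzp := lt_of_le_of_ne (not_lt.1 hh) (hne z hz).1
        exact hpx (π.1.symm (π.1.trans hz (π.noncrossing hzp h1 h2 (π.1.symm hyz) hpq)))
      · by_contra hh
        have hqz := lt_of_le_of_ne (not_lt.1 hh) (hne z hz).2.symm
        exact hpx (π.1.trans (π.noncrossing h1 h2 hqz hpq hyz) (π.1.symm hy))
    exact ⟨hdir x c (π.1.refl _) hxc, hdir c x hxc (π.1.refl _)⟩
  rcases hx with hx | hx
  · exact key a hpa hx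
  · exact (key b hpb hx).trans (h p q hpq hpa hpb hlt).symm

/-- The noncrossing partition obtained by merging the blocks of `a` and `b`. -/
def merge (π : NCPart m) (a b : Fin m) (h : Mergeable π a b) : NCPart m :=
  ⟨mergeSetoid π.1 a b, by
    intro w x y z hwx hxy hyz hwy hxz
    rcases hwy with hwy | ⟨hw, hy⟩ <;> rcases hxz with hxz | ⟨hx, hz⟩
    · exact Or.inl (π.noncrossing hwx hxy hyz hwy hxz)
    · by_cases hw : π.1 w a ∨ π.1 w b
      · exact Or.inr ⟨hw, hx⟩
      · rw [not_or] at hw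
        have h1 := (h.between hwy hw.1 hw.2 (hwx.trans hxy) hx).1 ⟨hwx, hxy⟩
        have h2 := (h.between hwy hw.1 hw.2 (hwx.trans hxy) hz).2 h1
        exact absurd (h2.2.trans hyz) (lt_irrefl _)
    · by_cases hx : π.1 x a ∨ π.1 x b
      · exact Or.inr ⟨hw, hx⟩
      · rw [not_or] at hx
        have h1 := (h.between hxz hx.1 hx.2 (hxy.trans hyz) hy).1 ⟨hxy, hyz⟩
        have h2 := (h.between hxz hx.1 hx.2 (hxy.trans hyz) hw).2 h1
        exact absurd (h2.1.trans hwx) (lt_irrefl _)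
    · exact Or.inr ⟨hw, hx⟩⟩

theorem merge_rel_self {π : NCPart m} {a b : Fin m} (h : Mergeable π a b) :
    (π.merge a b h).1 a b := Or.inr ⟨Or.inl (π.1.refl _), Or.inr (π.1.refl _)⟩

theorem le_merge {π : NCPart m} {a b : Fin m} (h : Mergeable π a b) : π ≤ π.merge a b h :=
  le_iff.2 fun _ _ => Or.inl

theorem merge_le {π ρ : NCPart m} {a b : Fin m} (h : Mergeable π a b) (hρ : π ≤ ρ)
    (hab : ρ.1 a b) : π.merge a b h ≤ ρ := by
  have key : ∀ x, π.1 x a ∨ π.1 x b → ρ.1 x a := fun x hx =>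
    hx.elim (le_iff.1 hρ _ _) fun hx => ρ.1.trans (le_iff.1 hρ _ _ hx) (ρ.1.symm hab)
  exact le_iff.2 fun x y hxy => hxy.elim (le_iff.1 hρ _ _) fun ⟨hx, hy⟩ =>
    ρ.1.trans (key x hx) (ρ.1.symm (key y hy))

/-- Two lost minima `x`, `y` in different blocks would each have a smaller vertex in the block of
the other, giving `y ≤ u < x ≤ v < y`. -/
theorem card_mins_le_merge {π : NCPart m} {a b : Fin m} (h : Mergeable π a b) :
    (π.mins 0).card ≤ ((π.merge a b h).mins 0).card + 1 := by
  have h1 : (π.mins 0 \ (π.merge a b h).mins 0).card ≤ 1 := by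
    refine Finset.card_le_one.2 fun x hx y hy => ?_
    rw [Finset.mem_sdiff, mem_mins, mem_mins] at hx hy
    have key : ∀ z : Fin m, (∀ w : Fin m, 0 ≤ (w : ℕ) → π.1 z w → z ≤ w) →
        ¬ (0 ≤ (z : ℕ) ∧ ∀ w : Fin m, 0 ≤ (w : ℕ) → (π.merge a b h).1 z w → z ≤ w) →
        (π.1 z a ∨ π.1 z b) ∧ ∃ w, w < z ∧ (π.1 w a ∨ π.1 w b) := by
      intro z hz hz'
      push Not at hz'
      obtain ⟨w, hw, hzw, hlt⟩ := hz' (Nat.zero_le _)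
      rcases hzw with hzw | ⟨h1, h2⟩
      · exact absurd (hz w hw hzw) (not_le.2 hlt)
      · exact ⟨h1, w, hlt, h2⟩
    obtain ⟨hxm, u, hux, hu⟩ := key x hx.1.2 hx.2
    obtain ⟨hym, v, hvy, hv⟩ := key y hy.1.2 hy.2
    by_cases hxy : π.1 x y
    · exact le_antisymm (hx.1.2 y (Nat.zero_le _) hxy) (hy.1.2 x (Nat.zero_le _) (π.1.symm hxy))
    have hyu : π.1 y u := by
      have hnu : ¬ π.1 x u := fun hh => absurd (hx.1.2 u (Nat.zero_le _) hh) (not_le.2 hux)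
      rcases hxm with hxm | hxm <;> rcases hym with hym | hym <;> rcases hu with hu | hu <;>
        first
        | exact π.1.trans hym (π.1.symm hu)
        | exact absurd (π.1.trans hxm (π.1.symm hu)) hnu
        | exact absurd (π.1.trans hxm (π.1.symm hym)) hxy
    have hxv : π.1 x v := by
      have hnv : ¬ π.1 y v := fun hh => absurd (hy.1.2 v (Nat.zero_le _) hh) (not_le.2 hvy)
      rcases hxm with hxm | hxm <;> rcases hym with hym | hym <;> rcases hv with hv | hv <;>
        first
        | exact π.1.trans hxm (π.1.symm hv)
        | exact absurd (π.1.trans hym (π.1.symm hv)) hnv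
        | exact absurd (π.1.trans hxm (π.1.symm hym)) hxy
    have e1 := hy.1.2 u (Nat.zero_le _) hyu
    have e2 := hx.1.2 v (Nat.zero_le _) hxv
    exact absurd ((e2.trans_lt hvy).trans (e1.trans_lt hux)) (lt_irrefl _)
  have h2 := Finset.card_le_card_sdiff_add_card (s := π.mins 0) (t := (π.merge a b h).mins 0)
  omega

/-- Below any larger partition two blocks can be merged. -/
theorem exists_mergeable {π ρ : NCPart m} (h : π < ρ) :
    ∃ a b, ρ.1 a b ∧ ¬ π.1 a b ∧ Mergeable π a b := by
  -- Take such a pair at minimal distance. A block of `π` separating it would, as `ρ` is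
  -- noncrossing, lie in the same block of `ρ` and yield a closer pair.
  have hex : ∃ d : ℕ, ∃ x y : Fin m, x < y ∧ ρ.1 x y ∧ ¬ π.1 x y ∧ (y : ℕ) = x + d := by
    obtain ⟨x, y, hlt, hρ, hπ⟩ := exists_rel_of_lt h
    exact ⟨y - x, x, y, hlt, hρ, hπ, by have : (x : ℕ) < y := hlt; omega⟩
  obtain ⟨a, b, hab, hρ, hπ, hd⟩ := Nat.find_spec hex
  have hmin : ∀ x y : Fin m, x < y → ρ.1 x y → (y : ℕ) < x + Nat.find hex → π.1 x y := by
    intro x y hxy hr hlt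
    by_contra hn
    refine Nat.find_min hex (m := y - x) ?_ ⟨x, y, hxy, hr, hn, ?_⟩ <;>
    · have : (x : ℕ) < y := hxy
      omega
  refine ⟨a, b, hρ, hπ, fun p q hpq hpa hpb hlt => ?_⟩
  have hpqρ := le_iff.1 h.le _ _ hpq
  have nab : (a : ℕ) < b := hab
  constructor
  · rintro ⟨h1, h2⟩
    refine ⟨h1.trans hab, ?_⟩
    by_contra hbq
    have hqb : q < b := lt_of_le_of_ne (not_lt.1 hbq) fun e => hpb (e ▸ hpq)
    have hpaρ : ρ.1 p a := ρ.noncrossing h1 h2 hqb hpqρ hρ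
    have n1 : (a : ℕ) < q := h2
    have n2 : (q : ℕ) < b := hqb
    have := hmin a q h2 (ρ.1.trans (ρ.1.symm hpaρ) hpqρ) (by omega)
    exact hpa (π.1.trans hpq (π.1.symm this))
  · rintro ⟨h1, h2⟩
    refine ⟨?_, hab.trans h2⟩
    by_contra hpa'
    have hap : a < p := lt_of_le_of_ne (not_lt.1 hpa') fun e => hpa (e ▸ π.1.refl _)
    have hr : ρ.1 a p := ρ.noncrossing hap h1 h2 hρ hpqρ
    have n1 : (a : ℕ) < p := hap
    have n2 : (p : ℕ) < b := h1
    exact hpa (π.1.symm (hmin a p hap hr (by omega)))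

theorem card_mins_covBy {π ρ : NCPart m} (h : π ⋖ ρ) :
    (ρ.mins 0).card + 1 = (π.mins 0).card := by
  obtain ⟨a, b, hρ, hπ, hm⟩ := exists_mergeable h.lt
  have hlt : π < π.merge a b hm := lt_of_le_of_ne (le_merge hm) fun e => hπ (by
    rw [e]
    exact merge_rel_self hm)
  have he : π.merge a b hm = ρ := (merge_le hm h.le hρ).eq_of_not_lt (h.2 hlt)
  have h1 := card_mins_le_merge hm
  have h2 := Finset.card_lt_card (mins_zero_ssubset h.lt)
  rw [he] at h1
  omega

end NCPart

/-! ### Maximal chains and their labels -/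

namespace MaxChain

variable {n : ℕ}

theorem elem_mono (c : MaxChain n) : Monotone c.elem :=
  Fin.monotone_iff_le_succ.2 fun i => (c.covBy i).le

/-- Every chain is contained in a maximal chain, and all of these have the same length. -/
theorem exists_of_isChain {s : Set (NCPart (n + 1))} (hs : IsChain (· ≤ ·) s) :
    ∃ c : MaxChain n, s ⊆ Set.range c.elem := by
  obtain ⟨M, hM, hsM⟩ := IsChain.exists_maxChain hs
  have htot : ∀ {x y}, x ∈ M → y ∈ M → x ≤ y ∨ y ≤ x := fun hx hy => hM.1.total hx hy
  have hbot : ⊥ ∈ M := hM.bot_mem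
  have htop : ⊤ ∈ M := hM.top_mem
  have hstep : ∀ x ∈ M, x ≠ ⊤ → ∃ y ∈ M, x ⋖ y := by
    intro x hx hxt
    obtain ⟨y, hy⟩ := (Set.toFinite {y | y ∈ M ∧ x < y}).exists_minimal ⟨⊤, htop, hxt.lt_top⟩
    -- A partition strictly between `x` and its successor in `M` would be comparable to all of `M`,
    -- against maximality.
    refine ⟨y, hy.prop.1, hy.prop.2, fun z hxz hzy => ?_⟩
    have hz : IsChain (· ≤ ·) (insert z M) := hM.1.insert fun w hw _ => by
      rcases htot hx hw with h | h
      · rcases h.eq_or_lt with rfl | h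
        · exact Or.inr hxz.le
        · rcases htot hy.prop.1 hw with h' | h'
          · exact Or.inl (hzy.le.trans h')
          · exact Or.inl (hzy.le.trans (hy.le_of_le ⟨hw, h⟩ h'))
      · exact Or.inr (h.trans hxz.le)
    have hzM : z ∈ M := by
      rw [hM.2 hz (Set.subset_insert _ _)]
      exact Set.mem_insert _ _
    exact hy.not_lt ⟨hzM, hxz⟩ hzy
  have hex : ∀ i : ℕ, i ≤ n → ∃ x ∈ M, (x.mins 0).card + i = n + 1 := by
    intro i
    induction i with
    | zero => exact fun _ => ⟨⊥, hbot, by rw [NCPart.card_mins_bot]; omega⟩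
    | succ i ih =>
      intro hi
      obtain ⟨x, hx, hc⟩ := ih (by omega)
      obtain ⟨y, hy, hxy⟩ := hstep x hx (by
        rintro rfl
        rw [NCPart.card_mins_top (Nat.succ_pos _)] at hc
        omega)
      have := NCPart.card_mins_covBy hxy
      exact ⟨y, hy, by omega⟩
  choose! f hfM hfc using hex
  have hlt : ∀ {x y}, x ∈ M → y ∈ M → (y.mins 0).card < (x.mins 0).card → x < y := by
    intro x y hx hy h
    rcases htot hx hy with h' | h'
    · exact lt_of_le_of_ne h' (by rintro rfl; exact lt_irrefl _ h)
    · exact absurd (Finset.card_le_card (NCPart.mins_subset h' 0)) (not_le.2 h)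
  have heq : ∀ {x y}, x ∈ M → y ∈ M → (y.mins 0).card = (x.mins 0).card → x = y := by
    intro x y hx hy h
    by_contra hne
    rcases htot hx hy with h' | h'
    · exact (Finset.card_lt_card (NCPart.mins_zero_ssubset (lt_of_le_of_ne h' hne))).ne h
    · exact (Finset.card_lt_card (NCPart.mins_zero_ssubset
        (lt_of_le_of_ne h' (Ne.symm hne)))).ne h.symm
  refine ⟨⟨fun i => f i, ?_, ?_, fun i => ?_⟩, fun x hx => ?_⟩
  · refine heq (hfM _ (Nat.zero_le _)) hbot ?_
    have := hfc 0 (Nat.zero_le _)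
    rw [NCPart.card_mins_bot]
    simp only [Fin.val_zero]
    omega
  · refine heq (hfM _ le_rfl) htop ?_
    have := hfc n le_rfl
    rw [NCPart.card_mins_top (Nat.succ_pos _)]
    simp only [Fin.val_last]
    omega
  · have hi := i.2
    have h1 := hfc i (by omega)
    have h2 := hfc (i + 1) (by omega)
    simp only [Fin.val_castSucc, Fin.val_succ]
    refine ⟨hlt (hfM _ (by omega)) (hfM _ (by omega)) (by omega), fun z hz1 hz2 => ?_⟩
    have h3 := Finset.card_lt_card (NCPart.mins_zero_ssubset hz1)
    have h4 := Finset.card_lt_card (NCPart.mins_zero_ssubset hz2)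
    omega
  · have h1 := x.card_mins_pos (k := 0) (Nat.succ_pos _)
    have h2 := Finset.card_le_card (NCPart.mins_subset (bot_le (a := x)) 0)
    rw [NCPart.card_mins_bot] at h2
    -- The position of `x` is its rank: `n + 1` minus its number of blocks.
    refine ⟨⟨n + 1 - (x.mins 0).card, by omega⟩, heq (hfM _ ?_) (hsM hx) ?_⟩
    · change n + 1 - (x.mins 0).card ≤ n
      omega
    · have h3 := hfc (n + 1 - (x.mins 0).card) (by omega)
      change (x.mins 0).card = ((f (n + 1 - (x.mins 0).card)).mins 0).card
      omega

/-! ### Stanley's labels -/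

theorem transposition_apply_ne (c : MaxChain n) (i : Fin n) (v : Fin (n + 1)) :
    c.transposition i v ≠ v ↔ (c.elem i.castSucc).next v ≠ (c.elem i.succ).next v := by
  rw [not_iff_not, transposition, Equiv.Perm.mul_apply, Equiv.Perm.inv_eq_iff_eq]
  exact eq_comm

theorem next_eq_of_lt_stanley (c : MaxChain n) {i : Fin n} {v : Fin (n + 1)}
    (h : (v : ℕ) + 1 < c.stanley i) : (c.elem i.castSucc).next v = (c.elem i.succ).next v := by
  by_contra hne
  exact Nat.notMem_of_lt_sInf h ⟨v, (c.transposition_apply_ne i v).2 hne, rfl⟩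

/-- Take the largest `x` with a larger partner `y` in `ρ` but not in `π`. If `x < k`, then `x` has
the same successor in both partitions, and that successor with `y` would be a later such pair. -/
theorem exists_rel_of_next_eq {m : ℕ} {π ρ : NCPart m} (h : π < ρ) {k : ℕ}
    (hk : ∀ v : Fin m, (v : ℕ) < k → π.next v = ρ.next v) :
    ∃ x y : Fin m, k ≤ (x : ℕ) ∧ k ≤ (y : ℕ) ∧ ρ.1 x y ∧ ¬ π.1 x y := by
  have hne : {x : Fin m | ∃ y, x < y ∧ ρ.1 x y ∧ ¬ π.1 x y}.Nonempty :=
    let ⟨x, y, h⟩ := NCPart.exists_rel_of_lt h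
    ⟨x, y, h⟩
  obtain ⟨x, hx⟩ := (Set.toFinite _).exists_maximal hne
  obtain ⟨y, hxy, hρ, hπ⟩ := hx.prop
  have hval : (x : ℕ) < y := hxy
  by_cases hkx : k ≤ (x : ℕ)
  · exact ⟨x, y, hkx, by omega, hρ, hπ⟩
  obtain ⟨h1, h2⟩ := ρ.next_of_lt hρ hxy
  have hu : π.1 x (ρ.next x) := hk x (not_le.1 hkx) ▸ π.next_mem x
  have hun : ¬ π.1 (ρ.next x) y := fun hh => hπ (π.1.trans hu hh)
  have hlt : ρ.next x < y := lt_of_le_of_ne h2 fun e => hun (e ▸ π.1.refl _)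
  exact absurd h1 (hx.not_gt ⟨y, hlt, ρ.1.trans (ρ.1.symm (ρ.next_mem x)) hρ, hun⟩)

theorem stanley_pos (c : MaxChain n) (i : Fin n) : 1 ≤ c.stanley i := by
  have hne : {k : ℕ | ∃ v : Fin (n + 1), c.transposition i v ≠ v ∧ k = (v : ℕ) + 1}.Nonempty := by
    by_contra hne
    obtain ⟨x, y, hx, -⟩ := exists_rel_of_next_eq (c.covBy i).lt (k := n + 1) fun v _ => by
      by_contra h
      exact hne ⟨_, v, (c.transposition_apply_ne i v).2 h, rfl⟩
    exact absurd x.2 (not_lt.2 hx)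
  obtain ⟨v, -, hv⟩ := Nat.sInf_mem hne
  exact (Nat.le_add_left 1 v).trans hv.ge

/-- A label above `k` leaves the successors of the first `k` vertices unchanged, so the step merges
blocks already when restricted to the other `n + 1 - k` vertices. The number of restricted blocks
falls from `n + 1 - k` to no less than `1`. -/
theorem card_stanley_gt (c : MaxChain n) {k : ℕ} (hk : k ≤ n) :
    (Finset.univ.filter fun i => k < c.stanley i).card ≤ n - k := by
  have hstep : ∀ i : Fin n, ((c.elem i.succ).mins k).card + (if k < c.stanley i then 1 else 0) ≤
      ((c.elem i.castSucc).mins k).card := by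
    intro i
    split_ifs with h
    · obtain ⟨x, y, hx, hy, hρ, hπ⟩ := exists_rel_of_next_eq (c.covBy i).lt (k := k) fun v hv =>
        c.next_eq_of_lt_stanley (by omega)
      exact Finset.card_lt_card (NCPart.mins_ssubset (c.covBy i).le hx hy hρ hπ)
    · exact Finset.card_le_card (NCPart.mins_subset (c.covBy i).le k)
  have hsum := Finset.sum_le_sum fun i (_ : i ∈ (Finset.univ : Finset (Fin n))) => hstep i
  rw [Finset.sum_add_distrib, ← Finset.card_filter] at hsum
  have h1 := Fin.sum_univ_succ fun j => ((c.elem j).mins k).card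
  have h2 := Fin.sum_univ_castSucc fun j => ((c.elem j).mins k).card
  rw [c.elem_zero, NCPart.card_mins_bot] at h1
  have h3 := (c.elem (Fin.last n)).card_mins_pos (k := k) (by omega)
  omega

theorem stanley_mem_parkingFunctions (c : MaxChain n) : c.stanley ∈ parkingFunctions n := by
  refine ⟨c.stanley_pos, fun i => ?_⟩
  by_contra hlt
  have hi := i.2
  -- If the sorted entry at `i` is too large, so are all `n - i` entries from there on, while only
  -- `n - (i + 1)` are allowed.
  have hsub : (Finset.Ici i).map (Tuple.sort c.stanley).toEmbedding ⊆
      Finset.univ.filter fun j => (i : ℕ) + 1 < c.stanley j := by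
    intro j hj
    obtain ⟨l, hl, rfl⟩ := Finset.mem_map.1 hj
    have := Tuple.monotone_sort c.stanley (Finset.mem_Ici.1 hl)
    exact Finset.mem_filter.2 ⟨Finset.mem_univ _, (not_le.1 hlt).trans_le this⟩
  have h1 := (Finset.card_le_card hsub).trans (c.card_stanley_gt (by omega))
  rw [Finset.card_map, Fin.card_Ici] at h1
  omega

end MaxChain

/-! ### The position of the last vertex -/

namespace NCPart

variable {n : ℕ}

/-- The vertex before the last one. -/
def penult (n : ℕ) : Fin (n + 1) := ⟨n - 1, by omega⟩

theorem penult_lt_last (hn : 2 ≤ n) : penult n < Fin.last n := by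
  change n - 1 < n
  omega

theorem le_penult {v : Fin (n + 1)} (hv : v ≠ Fin.last n) : v ≤ penult n := by
  have h1 := v.2
  have h2 : (v : ℕ) ≠ n := fun h => hv (Fin.ext h)
  change (v : ℕ) ≤ n - 1
  omega

/-- The last vertex is a block. -/
def LastIsolated (x : NCPart (n + 1)) : Prop := ∀ w, x.1 (Fin.last n) w → w = Fin.last n

/-- The last two vertices are in one block. -/
def LastJoined (x : NCPart (n + 1)) : Prop := x.1 (penult n) (Fin.last n)

/-- The block of the last vertex has other elements, but not the vertex before it. -/
def LastSkips (x : NCPart (n + 1)) : Prop := ¬ x.LastIsolated ∧ ¬ x.LastJoined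

theorem LastIsolated.mono {x y : NCPart (n + 1)} (h : x ≤ y) (hy : y.LastIsolated) :
    x.LastIsolated := fun w hw => hy w (le_iff.1 h _ _ hw)

theorem LastJoined.mono {x y : NCPart (n + 1)} (h : x ≤ y) (hx : x.LastJoined) :
    y.LastJoined := le_iff.1 h _ _ hx

theorem lastIsolated_bot : (⊥ : NCPart (n + 1)).LastIsolated := fun _ hw => Eq.symm hw

theorem lastJoined_top : (⊤ : NCPart (n + 1)).LastJoined := trivial

theorem LastJoined.not_lastIsolated (hn : 2 ≤ n) {x : NCPart (n + 1)} (h : x.LastJoined) :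
    ¬ x.LastIsolated := fun h' => (penult_lt_last hn).ne (h' _ (x.1.symm h))

/-- The partition in which the last vertex is a block and that otherwise agrees with `x`. -/
def isolateLast (x : NCPart (n + 1)) : NCPart (n + 1) :=
  ⟨{ r := fun v w => v = w ∨ x.1 v w ∧ v ≠ Fin.last n ∧ w ≠ Fin.last n
     iseqv :=
      { refl := fun _ => Or.inl rfl
        symm := fun h => h.imp Eq.symm fun h => ⟨x.1.symm h.1, h.2.2, h.2.1⟩
        trans := by
          rintro u v w (rfl | h) (rfl | h')
          · exact Or.inl rfl
          · exact Or.inr h'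
          · exact Or.inr h
          · exact Or.inr ⟨x.1.trans h.1 h'.1, h.2.1, h'.2.2⟩ } },
    by
      rintro a b c d hab hbc hcd (rfl | h) (rfl | h')
      · exact absurd (hab.trans hbc) (lt_irrefl _)
      · exact absurd (hab.trans hbc) (lt_irrefl _)
      · exact absurd (hbc.trans hcd) (lt_irrefl _)
      · exact Or.inr ⟨x.noncrossing hab hbc hcd h.1 h'.1, h.2.1, h'.2.1⟩⟩

theorem isolateLast_rel {x : NCPart (n + 1)} {v w : Fin (n + 1)} :
    x.isolateLast.1 v w ↔ v = w ∨ x.1 v w ∧ v ≠ Fin.last n ∧ w ≠ Fin.last n := Iff.rfl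

theorem isolateLast_le (x : NCPart (n + 1)) : x.isolateLast ≤ x :=
  le_iff.2 fun _ _ h => h.elim (fun e => e ▸ x.1.refl _) And.left

theorem le_isolateLast {x y : NCPart (n + 1)} (h : x ≤ y) (hx : x.LastIsolated) :
    x ≤ y.isolateLast := le_iff.2 fun v w hvw => by
  by_cases hv : v = Fin.last n
  · subst hv
    exact Or.inl (hx _ hvw).symm
  by_cases hw : w = Fin.last n
  · subst hw
    exact Or.inl (hx _ (x.1.symm hvw))
  · exact Or.inr ⟨le_iff.1 h _ _ hvw, hv, hw⟩

theorem next_eq_of_isLeast {m : ℕ} {x y : NCPart m} {v : Fin m} (h : v < x.next v)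
    (hy : y.1 v (x.next v)) (hle : y.1 v (y.next v) → v < y.next v → x.1 v (y.next v)) :
    y.next v = x.next v := by
  obtain ⟨h1, h2⟩ := y.next_of_lt hy h
  exact le_antisymm h2 (x.next_of_lt (hle (y.next_mem v) h1) h1).2

end NCPart

/-! ### Chains without the label `n` -/

open NCPart

namespace MaxChain

variable {n : ℕ}

theorem stanley_eq_iff (hn : 2 ≤ n) (c : MaxChain n) (i : Fin n) :
    c.stanley i = n ↔ (c.elem i.castSucc).LastIsolated ∧ (c.elem i.succ).LastJoined := by
  have hlt := (c.covBy i).lt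
  have hpl := penult_lt_last hn
  have hmoved : ∀ v, c.transposition i v ≠ v ↔ _ := c.transposition_apply_ne i
  have hsucc : ((penult n : Fin (n + 1)) : ℕ) + 1 = n := by change n - 1 + 1 = n; omega
  have hlow : ∀ v : Fin (n + 1), v < penult n ↔ (v : ℕ) + 1 < n := fun v => by
    rw [Fin.lt_def]
    omega
  constructor
  · intro h
    have hfix : ∀ v, v < penult n → c.transposition i v = v := fun v hv => by
      by_contra hne
      exact (hmoved v).1 hne (c.next_eq_of_lt_stanley (((hlow v).1 hv).trans_eq h.symm))
    have hne : {k : ℕ | ∃ v : Fin (n + 1), c.transposition i v ≠ v ∧ k = (v : ℕ) + 1}.Nonempty :=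
      Nat.nonempty_of_pos_sInf (show 0 < c.stanley i by omega)
    obtain ⟨v, hv, hk⟩ := Nat.sInf_mem hne
    have hvp : v = penult n := Fin.ext (by
      have : c.stanley i = (v : ℕ) + 1 := hk
      omega)
    subst hvp
    -- All smaller vertices are fixed and `penult n` is moved, so by injectivity only the last
    -- vertex is left as its image.
    have himg : c.transposition i (penult n) = Fin.last n := by
      by_contra hne'
      rcases (le_penult hne').lt_or_eq with h1 | h1
      · exact hv ((c.transposition i).injective (hfix _ h1))
      · exact hv h1
    have hnext : (c.elem i.succ).next (penult n) = (c.elem i.castSucc).next (Fin.last n) := by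
      rw [transposition, Equiv.Perm.mul_apply, Equiv.Perm.inv_eq_iff_eq] at himg
      exact himg
    have hj : (c.elem i.succ).LastJoined := by
      have h1 := (c.elem i.succ).next_mem (penult n)
      rw [hnext] at h1
      exact (c.elem i.succ).1.trans h1
        ((c.elem i.succ).1.symm (le_iff.1 hlt.le _ _ ((c.elem i.castSucc).next_mem _)))
    -- With a companion `w ≤ penult n` in the lower partition, the last vertex would have a
    -- successor at most `penult n`; but by `hnext` it is the successor of `penult n` in the upper
    -- one, which is larger.
    refine ⟨fun w hw => ?_, hj⟩
    by_contra hwl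
    have h1 := ((c.elem i.succ).next_of_lt hj hpl).1
    rw [hnext] at h1
    have h2 := (c.elem i.castSucc).next_le_of_le hw (Fin.le_last _)
    exact absurd (h1.trans_le (h2.trans (le_penult hwl))) (lt_irrefl _)
  · rintro ⟨hS, hT⟩
    -- Isolating the last vertex in the upper partition gives something strictly below it and still
    -- above the lower one, so the covering relation forces equality.
    have heq : (c.elem i.succ).isolateLast = c.elem i.castSucc := by
      refine ((le_isolateLast hlt.le hS).eq_of_not_lt fun hh => (c.covBy i).2 hh ?_).symm
      refine lt_of_le_of_ne (isolateLast_le _) fun e => ?_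
      have hT' := hT
      rw [← e] at hT'
      rcases isolateLast_rel.1 hT' with h | h
      · exact hpl.ne h
      · exact h.2.2 rfl
    have hmem : n ∈ {k : ℕ | ∃ v : Fin (n + 1), c.transposition i v ≠ v ∧ k = (v : ℕ) + 1} := by
      refine ⟨penult n, (hmoved _).2 fun h => ?_, hsucc.symm⟩
      have h1 := (c.elem i.succ).next_of_lt hT hpl
      have h2 : (c.elem i.succ).next (penult n) = Fin.last n := by
        by_contra hne
        exact absurd (h1.1.trans_le (le_penult hne)) (lt_irrefl _)
      have h3 := (c.elem i.castSucc).next_mem (penult n)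
      rw [h, h2] at h3
      exact hpl.ne (hS _ ((c.elem i.castSucc).1.symm h3))
    refine le_antisymm (Nat.sInf_le hmem) (le_csInf ⟨n, hmem⟩ ?_)
    rintro _ ⟨v, hv, rfl⟩
    by_contra hvn
    refine (hmoved v).1 hv ?_
    rw [← heq]
    have hvp := (hlow v).2 (not_le.1 hvn)
    have hvl := (hvp.trans hpl).ne
    set ρ := c.elem i.succ
    -- Either `v` has a later block-mate other than the last vertex, which bounds both successors,
    -- or `v` is not with the last vertex (otherwise `penult n` would be such a mate) and both
    -- successors wrap around to the least vertex of the block.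
    by_cases hex : ∃ w, v < w ∧ w ≠ Fin.last n ∧ ρ.1 v w
    · obtain ⟨w, hvw, hwl, hr⟩ := hex
      obtain ⟨h1, h2⟩ := ρ.next_of_lt hr hvw
      have hnl : ρ.next v ≠ Fin.last n := fun e =>
        hwl (le_antisymm (Fin.le_last _) (e ▸ h2))
      exact next_eq_of_isLeast h1 (Or.inr ⟨ρ.next_mem v, hvl, hnl⟩)
        fun h _ => le_iff.1 (isolateLast_le ρ) _ _ h
    · push Not at hex
      have hvlast : ¬ ρ.1 v (Fin.last n) := fun h =>
        hex _ hvp hpl.ne (ρ.1.trans h (ρ.1.symm hT))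
      have hle : ρ.next v ≤ v := by
        by_contra hh
        by_cases hl : ρ.next v = Fin.last n
        · exact hvlast (hl ▸ ρ.next_mem v)
        · exact hex _ (not_le.1 hh) hl (ρ.next_mem v)
      have hle' : ρ.isolateLast.next v ≤ v := by
        by_contra hh
        have hm := le_iff.1 (isolateLast_le ρ) _ _ (ρ.isolateLast.next_mem v)
        by_cases hl : ρ.isolateLast.next v = Fin.last n
        · exact hvlast (hl ▸ hm)
        · exact hex _ (not_le.1 hh) hl hm
      refine le_antisymm (ρ.isolateLast.next_le_of_le (Or.inr ⟨ρ.next_mem v, hvl, ?_⟩) hle')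
        (ρ.next_le_of_le (le_iff.1 (isolateLast_le ρ) _ _ (ρ.isolateLast.next_mem v)) hle)
      exact (hle.trans_lt (hvp.trans hpl)).ne

/-- The label `n` does not occur iff the last vertex is at some time in a block with other vertices,
but without its predecessor. -/
theorem stanley_mem_iff (hn : 2 ≤ n) (c : MaxChain n) :
    c.stanley ∈ parkingFunctionsUndesired n n ↔ ∃ j, (c.elem j).LastSkips := by
  have h1 : c.stanley ∈ parkingFunctionsUndesired n n ↔ n ∉ Set.range c.stanley :=
    ⟨fun h => h.2.1.2.2, fun h => ⟨c.stanley_mem_parkingFunctions,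
      ⟨by omega, le_rfl, h⟩, fun _ hj => hj.2.1⟩⟩
  rw [h1]
  constructor
  · intro h
    by_contra hne
    push Not at hne
    have key : ∀ j : Fin (n + 1), (c.elem j).LastIsolated := by
      intro j
      induction j using Fin.induction with
      | zero => rw [c.elem_zero]; exact lastIsolated_bot
      | succ i ih =>
        by_contra hi
        refine h ⟨i, (c.stanley_eq_iff hn i).2 ⟨ih, ?_⟩⟩
        by_contra hT
        exact hne _ ⟨hi, hT⟩
    have := key (Fin.last n)
    rw [c.elem_last] at this
    exact lastJoined_top.not_lastIsolated hn this
  · rintro ⟨j, hj⟩ ⟨i, hi⟩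
    obtain ⟨hS, hT⟩ := (c.stanley_eq_iff hn i).1 hi
    rcases le_or_gt j i.castSucc with h | h
    · exact hj.1 (hS.mono (c.elem_mono h))
    · exact hj.2 (hT.mono (c.elem_mono (Fin.castSucc_lt_iff_succ_le.1 h)))

end MaxChain

/-! ### The order `SkipLE` and its join points -/

namespace NCPart

variable {n : ℕ}

theorem LastSkips.ne_bot {g : NCPart (n + 1)} (h : g.LastSkips) : g ≠ ⊥ := by
  rintro rfl
  exact h.1 lastIsolated_bot

theorem LastSkips.ne_top {g : NCPart (n + 1)} (h : g.LastSkips) : g ≠ ⊤ := by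
  rintro rfl
  exact h.2 lastJoined_top

/-- The order relation `x ≤ y` restricted to those pairs that lie on a common maximal chain through
an element with `LastSkips`, as far as that depends on the part of the chain from `x` to `y`. -/
def SkipLE (x y : NCPart (n + 1)) : Prop :=
  x ≤ y ∧ (x.LastIsolated → y.LastJoined → ∃ g : NCPart (n + 1), g.LastSkips ∧ x ≤ g ∧ g ≤ y)

theorem skipLE_of_not_lastIsolated {x y : NCPart (n + 1)} (h : x ≤ y) (hx : ¬ x.LastIsolated) :
    SkipLE x y := ⟨h, fun h' => absurd h' hx⟩

theorem skipLE_of_not_lastJoined {x y : NCPart (n + 1)} (h : x ≤ y) (hy : ¬ y.LastJoined) :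
    SkipLE x y := ⟨h, fun _ h' => absurd h' hy⟩

theorem SkipLE.trans {x y z : NCPart (n + 1)} (h : SkipLE x y) (h' : SkipLE y z) :
    SkipLE x z := by
  refine ⟨h.1.trans h'.1, fun hx hz => ?_⟩
  by_cases h1 : y.LastIsolated
  · obtain ⟨g, hg, h2, h3⟩ := h'.2 h1 hz
    exact ⟨g, hg, h.1.trans h2, h3⟩
  by_cases h2 : y.LastJoined
  · obtain ⟨g, hg, h3, h4⟩ := h.2 hx h2
    exact ⟨g, hg, h3, h4.trans h'.1⟩
  · exact ⟨y, ⟨h1, h2⟩, h.1, h'.1⟩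

/-- The partial order given by `SkipLE`. -/
abbrev skipOrder (hn : 2 ≤ n) : PartialOrder (NCPart (n + 1)) where
  le := SkipLE
  lt x y := SkipLE x y ∧ ¬ SkipLE y x
  lt_iff_le_not_ge _ _ := Iff.rfl
  le_refl _ := ⟨le_rfl, fun h h' => absurd h (h'.not_lastIsolated hn)⟩
  le_trans _ _ _ := SkipLE.trans
  le_antisymm _ _ h h' := le_antisymm h.1 h'.1

/-- A block of `z` separating `m` from the last vertex would have an element below `m`, and
noncrossing in `t` would put that element in the block whose minimum is `m`. -/
theorem mergeable_last {z t : NCPart (n + 1)} (hzt : z ≤ t) {m : Fin (n + 1)}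
    (hm : t.1 (Fin.last n) m) (hmin : ∀ w, t.1 (Fin.last n) w → m ≤ w) :
    Mergeable z m (Fin.last n) := by
  intro p q hpq _ hpl hlt
  refine ⟨fun ⟨h1, h2⟩ => ?_, fun ⟨_, h⟩ => absurd (Fin.le_last q) (not_le.2 h)⟩
  have hql : q < Fin.last n := lt_of_le_of_ne (Fin.le_last q) fun e => hpl (e ▸ hpq)
  have hpm := t.noncrossing h1 h2 hql (le_iff.1 hzt _ _ hpq) (t.1.symm hm)
  exact absurd (hmin p (t.1.trans hm (t.1.symm hpm))) (not_le.2 h1)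

/-- Below a partition `t` with `LastJoined`, the partitions that do not have this property have a
join point: joining the last vertex with the least vertex of its block in `t`. -/
theorem exists_join_lastSkips (hn : 2 ≤ n) {t : NCPart (n + 1)} (ht : t.LastJoined)
    (hbt : SkipLE ⊥ t) :
    ∃ e : NCPart (n + 1), e.LastSkips ∧ e ≤ t ∧ ∀ z, SkipLE z t → ¬ z.LastJoined →
      ∃ j : NCPart (n + 1), j.LastSkips ∧ z ≤ j ∧ e ≤ j ∧ j ≤ t ∧ ∀ w, z ≤ w → e ≤ w → j ≤ w := by
  have hpl := penult_lt_last hn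
  obtain ⟨m, hm⟩ := (Set.toFinite {w | t.1 (Fin.last n) w}).exists_minimal
    ⟨Fin.last n, t.1.refl _⟩
  have hmin : ∀ w, t.1 (Fin.last n) w → m ≤ w := fun w hw => not_lt.1 (hm.not_lt hw)
  have hskip : ∀ g : NCPart (n + 1), g.LastSkips → g ≤ t →
      ∃ w, w < penult n ∧ m ≤ w ∧ g.1 (Fin.last n) w := by
    intro g hg hgt
    obtain ⟨h1, h2⟩ := hg
    unfold LastIsolated at h1
    push Not at h1
    obtain ⟨w, hw, hwl⟩ := h1
    refine ⟨w, lt_of_le_of_ne (le_penult hwl) ?_, hmin w (le_iff.1 hgt _ _ hw), hw⟩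
    rintro rfl
    exact h2 (g.1.symm hw)
  have hmp : m < penult n := by
    obtain ⟨g, hg, -, hgt⟩ := hbt.2 lastIsolated_bot ht
    obtain ⟨w, hwp, hmw, -⟩ := hskip g hg hgt
    exact hmw.trans_lt hwp
  have key : ∀ z, SkipLE z t → ¬ z.LastJoined → ∃ j : NCPart (n + 1), j.LastSkips ∧ z ≤ j ∧
      j.1 m (Fin.last n) ∧ j ≤ t ∧ ∀ w, z ≤ w → w.1 m (Fin.last n) → j ≤ w := by
    intro z hz hzj
    have hmg := mergeable_last hz.1 hm.prop hmin
    refine ⟨z.merge m (Fin.last n) hmg, ⟨fun h => ?_, fun h => ?_⟩, le_merge hmg,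
      merge_rel_self hmg, merge_le hmg hz.1 (t.1.symm hm.prop),
      fun w hzw hw => merge_le hmg hzw hw⟩
    · exact (hmp.trans hpl).ne (h m ((z.merge m _ hmg).1.symm (merge_rel_self hmg)))
    · have hzm : z.1 (penult n) m := by
        rcases h with h | ⟨h | h, -⟩
        · exact absurd h hzj
        · exact h
        · exact absurd h hzj
      -- This is where `SkipLE z t` is needed. If merging joined the last two vertices, `z` and
      -- hence `g` would connect `m` with `penult n`. The last vertex has a companion `w` in `g`
      -- with `m ≤ w < penult n`, so noncrossing would make `g` joined.
      obtain ⟨g, hg, hzg, hgt⟩ : ∃ g : NCPart (n + 1), g.LastSkips ∧ z ≤ g ∧ g ≤ t := by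
        by_cases hzi : z.LastIsolated
        · exact hz.2 hzi ht
        · exact ⟨z, ⟨hzi, hzj⟩, le_rfl, hz.1⟩
      obtain ⟨w, hwp, hmw, hgw⟩ := hskip g hg hgt
      have hpm := le_iff.1 hzg _ _ hzm
      have hwm : g.1 m w := by
        rcases hmw.eq_or_lt with rfl | hlt
        · exact g.1.refl _
        · exact g.noncrossing hlt hwp hpl (g.1.symm hpm) (g.1.symm hgw)
      exact hg.2 (g.1.trans hpm (g.1.trans hwm (g.1.symm hgw)))
  obtain ⟨e, he1, -, he3, he4, he5⟩ := key ⊥ hbt fun h => hpl.ne h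
  refine ⟨e, he1, he4, fun z hz hzj => ?_⟩
  obtain ⟨j, hj1, hj2, hj3, hj4, hj5⟩ := key z hz hzj
  exact ⟨j, hj1, hj2, he5 j bot_le hj3, hj4,
    fun w hzw hew => hj5 w hzw (le_iff.1 hew _ _ he3)⟩

/-- The partitions other than `⊥` and `⊤` that lie between them in the order `SkipLE`. -/
def skipProper (n : ℕ) : Set (NCPart (n + 1)) :=
  {x | x ≠ ⊥ ∧ x ≠ ⊤ ∧ SkipLE ⊥ x ∧ SkipLE x ⊤}

theorem LastSkips.mem_skipProper {g : NCPart (n + 1)} (h : g.LastSkips) : g ∈ skipProper n :=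
  ⟨h.ne_bot, h.ne_top, skipLE_of_not_lastJoined bot_le h.2, skipLE_of_not_lastIsolated le_top h.1⟩

/-- The witness has the first and last vertices as its only nontrivial block; it is skipping because
`n ≥ 2` keeps the first vertex apart from `penult n`. -/
theorem skipLE_bot_top (hn : 2 ≤ n) : SkipLE (⊥ : NCPart (n + 1)) ⊤ := by
  have hpl := penult_lt_last hn
  have h0p : (0 : Fin (n + 1)) < penult n := by
    change 0 < n - 1
    omega
  have hmg : Mergeable (⊥ : NCPart (n + 1)) 0 (Fin.last n) := mergeable_last (t := ⊤) bot_le trivial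
    fun w _ => Fin.zero_le w
  refine ⟨bot_le, fun _ _ => ⟨merge ⊥ 0 (Fin.last n) hmg, ⟨fun h => ?_, fun h => ?_⟩, bot_le,
    le_top⟩⟩
  · exact (h0p.trans hpl).ne (h 0 ((merge ⊥ 0 _ hmg).1.symm (merge_rel_self hmg)))
  · rcases h with h | ⟨h | h, -⟩
    · exact hpl.ne h
    · exact h0p.ne h.symm
    · exact hpl.ne h

/-- Refinement and `SkipLE` agree on pairs with a skipping member, so the joins for refinement,
being skipping, are joins for `SkipLE`. -/
theorem hasJoinPoint_skipOrder (hn : 2 ≤ n) {t : NCPart (n + 1)} (ht : t.LastJoined)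
    (hbt : SkipLE ⊥ t) {L : Set (NCPart (n + 1))}
    (hL : ∀ z, z ∈ L ↔ z ∈ skipProper n ∧ ¬ z.LastJoined ∧ SkipLE z t) :
    @HasJoinPoint _ (skipOrder hn) L := by
  obtain ⟨e, he, het, h⟩ := exists_join_lastSkips hn ht hbt
  refine ⟨e, (hL e).2 ⟨he.mem_skipProper, he.2, skipLE_of_not_lastIsolated het he.1⟩,
    fun z hz => ?_⟩
  obtain ⟨-, hz2, hz3⟩ := (hL z).1 hz
  obtain ⟨j, hj, hzj, hej, hjt, hjw⟩ := h z hz3 hz2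
  exact ⟨j, (hL j).2 ⟨hj.mem_skipProper, hj.2, skipLE_of_not_lastIsolated hjt hj.1⟩,
    skipLE_of_not_lastJoined hzj hj.2, skipLE_of_not_lastJoined hej hj.2,
    fun w _ hzw hew => skipLE_of_not_lastIsolated (hjw w hzw.1 hew.1) hj.1⟩

theorem contractibleSpace_skipProper (hn : 2 ≤ n) :
    ContractibleSpace (geomRealization (@chainComplex _ (skipOrder hn) (skipProper n))) := by
  refine @contractibleSpace_chainComplex _ _ (skipOrder hn) _ {x | x.LastJoined} ?_ ?_
  · refine hasJoinPoint_skipOrder hn lastJoined_top (skipLE_bot_top hn) fun z =>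
      ⟨fun h => ⟨h.1, h.2, h.1.2.2.2⟩, fun h => ⟨h.1, h.2.1⟩⟩
  · rintro t ⟨ht1, ht2⟩
    exact hasJoinPoint_skipOrder hn ht2 ht1.2.2.1 fun z =>
      ⟨fun h => ⟨h.1.1, h.1.2, h.2⟩, fun h => ⟨⟨h.1, h.2.1⟩, h.2.2⟩⟩

end NCPart

/-! ### `SkipLE`-chains and admissible maximal chains -/

namespace MaxChain

variable {n : ℕ}

theorem mem_simplex {c : MaxChain n} {x : NCPart (n + 1)} :
    x ∈ c.simplex ↔ x ∈ Set.range c.elem ∧ x ≠ ⊥ ∧ x ≠ ⊤ := by simp [simplex]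

theorem skipLE_elem {c : MaxChain n} (hc : ∃ k, (c.elem k).LastSkips) {i j : Fin (n + 1)}
    (hij : i ≤ j) : SkipLE (c.elem i) (c.elem j) := by
  obtain ⟨k, hk⟩ := hc
  refine ⟨c.elem_mono hij, fun hi hj => ⟨_, hk, c.elem_mono ?_, c.elem_mono ?_⟩⟩
  · by_contra h
    exact hk.1 (hi.mono (c.elem_mono (not_le.1 h).le))
  · by_contra h
    exact hk.2 (hj.mono (c.elem_mono (not_le.1 h).le))

theorem exists_lastSkips_of_skipLE (hn : 2 ≤ n) {s : Finset (NCPart (n + 1))}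
    (hs : (s : Set (NCPart (n + 1))) ⊆ skipProper n)
    (hc : ∀ x ∈ s, ∀ y ∈ s, SkipLE x y ∨ SkipLE y x) :
    ∃ c : MaxChain n, (∃ k, (c.elem k).LastSkips) ∧ s ⊆ c.simplex := by
  suffices h : ∃ g : NCPart (n + 1), g.LastSkips ∧ ∀ x ∈ s, g ≤ x ∨ x ≤ g by
    obtain ⟨g, hg, hgs⟩ := h
    have hch : IsChain (· ≤ ·) (insert g (s : Set (NCPart (n + 1)))) := by
      refine IsChain.insert (fun x hx y hy _ => (hc x hx y hy).imp And.left And.left)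
        fun x hx _ => hgs x hx
    obtain ⟨c, hc⟩ := exists_of_isChain hch
    obtain ⟨k, hk⟩ := hc (Set.mem_insert _ _)
    exact ⟨c, ⟨k, hk.symm ▸ hg⟩, fun x hx =>
      mem_simplex.2 ⟨hc (Set.mem_insert_of_mem _ hx), (hs hx).1, (hs hx).2.1⟩⟩
  by_cases hex : ∃ g ∈ s, g.LastSkips
  · obtain ⟨g, hgs, hg⟩ := hex
    exact ⟨g, hg, fun x hx => (hc g hgs x hx).imp And.left And.left⟩
  -- Adjoining `⊥` and `⊤` guarantees that an isolated and a joined member exist. The skipping `g`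
  -- found between the largest isolated `a` and the smallest joined `b` is comparable to everything,
  -- as no member of `s` is itself skipping.
  have hc' : ∀ x ∈ insert ⊥ (insert ⊤ s), ∀ y ∈ insert ⊥ (insert ⊤ s),
      SkipLE x y ∨ SkipLE y x := by
    have h0 : ∀ y ∈ insert ⊥ (insert ⊤ s), SkipLE ⊥ y := by
      intro y hy
      rcases Finset.mem_insert.1 hy with rfl | hy
      · exact (skipOrder hn).le_refl _
      rcases Finset.mem_insert.1 hy with rfl | hy
      · exact skipLE_bot_top hn
      · exact (hs hy).2.2.1
    have h1 : ∀ y ∈ insert ⊥ (insert ⊤ s), SkipLE y ⊤ := by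
      intro y hy
      rcases Finset.mem_insert.1 hy with rfl | hy
      · exact skipLE_bot_top hn
      rcases Finset.mem_insert.1 hy with rfl | hy
      · exact (skipOrder hn).le_refl _
      · exact (hs hy).2.2.2
    intro x hx y hy
    rcases Finset.mem_insert.1 hx with rfl | hx'
    · exact Or.inl (h0 y hy)
    rcases Finset.mem_insert.1 hx' with rfl | hx'
    · exact Or.inr (h1 y hy)
    rcases Finset.mem_insert.1 hy with rfl | hy'
    · exact Or.inr (h0 x hx)
    rcases Finset.mem_insert.1 hy' with rfl | hy'
    · exact Or.inl (h1 x hx)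
    exact hc x hx' y hy'
  obtain ⟨a, ha⟩ := ((insert ⊥ (insert ⊤ s)).filter LastIsolated).exists_maximal
    ⟨⊥, Finset.mem_filter.2 ⟨by simp, lastIsolated_bot⟩⟩
  obtain ⟨b, hb⟩ := ((insert ⊥ (insert ⊤ s)).filter LastJoined).exists_minimal
    ⟨⊤, Finset.mem_filter.2 ⟨by simp, lastJoined_top⟩⟩
  obtain ⟨ha1, ha2⟩ := Finset.mem_filter.1 ha.prop
  obtain ⟨hb1, hb2⟩ := Finset.mem_filter.1 hb.prop
  have hab : SkipLE a b := (hc' a ha1 b hb1).resolve_right fun h =>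
    (hb2.mono h.1).not_lastIsolated hn ha2
  obtain ⟨g, hg, hag, hgb⟩ := hab.2 ha2 hb2
  refine ⟨g, hg, fun x hx => ?_⟩
  have hx' : x ∈ insert ⊥ (insert ⊤ s) := by simp [hx]
  by_cases hxi : x.LastIsolated
  · refine Or.inr (le_trans ?_ hag)
    rcases hc' x hx' a ha1 with h | h
    · exact h.1
    · exact ha.2 (Finset.mem_filter.2 ⟨hx', hxi⟩) h.1
  · have hxj : x.LastJoined := by
      by_contra hxj
      exact hex ⟨x, hx, hxi, hxj⟩
    refine Or.inl (hgb.trans ?_)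
    rcases hc' b hb1 x hx' with h | h
    · exact h.1
    · exact hb.le_of_le (Finset.mem_filter.2 ⟨hx', hxj⟩) h.1

end MaxChain

/-! ### The path poset and its link -/

namespace PathPoset

variable {n : ℕ} {A : Set (Fin n → ℕ)}

theorem le_of_elem_le {c : MaxChain n} (hc : c.stanley ∈ A) {i j : Fin (n + 1)} (hij : i ≤ j) :
    Relation.ReflTransGen (PathEdge A) (c.elem i) (c.elem j) := by
  induction j using Fin.induction with
  | zero => rw [le_antisymm hij (Fin.zero_le i)]
  | succ j ih =>
    rcases hij.eq_or_lt with rfl | hlt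
    · exact Relation.ReflTransGen.refl
    · exact (ih (Fin.le_castSucc_iff.2 hlt)).tail ⟨c, hc, j, rfl, rfl⟩

theorem isBot_iff (x : PathPoset A) : IsBot x ↔ x.val = ⊥ := by
  obtain ⟨y, c, hc, i, rfl⟩ := x
  constructor
  · intro h
    have h1 : Relation.ReflTransGen (PathEdge A) (c.elem i) (c.elem 0) :=
      h ⟨c.elem 0, c, hc, 0, rfl⟩
    exact le_bot_iff.1 ((le_of_reflTransGen h1).trans_eq c.elem_zero)
  · rintro h ⟨z, c', hc', j, rfl⟩
    change Relation.ReflTransGen (PathEdge A) (c.elem i) (c'.elem j)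
    have h' : c.elem i = c'.elem 0 := Eq.trans h c'.elem_zero.symm
    rw [h']
    exact le_of_elem_le hc' (Fin.zero_le j)

theorem isTop_iff (x : PathPoset A) : IsTop x ↔ x.val = ⊤ := by
  obtain ⟨y, c, hc, i, rfl⟩ := x
  constructor
  · intro h
    have h1 : Relation.ReflTransGen (PathEdge A) (c.elem (Fin.last n)) (c.elem i) :=
      h ⟨c.elem (Fin.last n), c, hc, Fin.last n, rfl⟩
    exact top_le_iff.1 (c.elem_last.symm.trans_le (le_of_reflTransGen h1))
  · rintro h ⟨z, c', hc', j, rfl⟩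
    change Relation.ReflTransGen (PathEdge A) (c'.elem j) (c.elem i)
    have h' : c.elem i = c'.elem (Fin.last n) := Eq.trans h c'.elem_last.symm
    rw [h']
    exact le_of_elem_le hc' (Fin.le_last j)

end PathPoset

section Link

variable {n : ℕ}

theorem mem_pathLink_of_subset_simplex {A : Set (Fin n → ℕ)} {c : MaxChain n} (hc : c.stanley ∈ A)
    {s : Finset (NCPart (n + 1))} (hne : s.Nonempty) (hs : s ⊆ c.simplex) :
    s ∈ (pathLink A).faces := by
  -- A section of `PathPoset.val` over the chain `c`; its value off the chain is irrelevant.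
  let f : NCPart (n + 1) → PathPoset A := fun x =>
    if h : x ∈ Set.range c.elem then ⟨x, c, hc, h⟩ else ⟨c.elem 0, c, hc, 0, rfl⟩
  have hf : ∀ x ∈ s, (f x).val = x := fun x hx => by
    have h := (MaxChain.mem_simplex.1 (hs hx)).1
    exact congrArg PathPoset.val (dif_pos h)
  refine ⟨s.image f, ⟨hne.image f, ?_, ?_⟩, ?_⟩
  · intro x hx y hy _
    obtain ⟨x, hx', rfl⟩ := Finset.mem_image.1 (Finset.mem_coe.1 hx)
    replace hx := hx'
    obtain ⟨y, hy', rfl⟩ := Finset.mem_image.1 (Finset.mem_coe.1 hy)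
    replace hy := hy'
    change Relation.ReflTransGen (PathEdge A) (f x).val (f y).val ∨
      Relation.ReflTransGen (PathEdge A) (f y).val (f x).val
    rw [hf x hx, hf y hy]
    obtain ⟨⟨i, rfl⟩, -⟩ := MaxChain.mem_simplex.1 (hs hx)
    obtain ⟨⟨j, rfl⟩, -⟩ := MaxChain.mem_simplex.1 (hs hy)
    exact (le_total i j).imp (PathPoset.le_of_elem_le hc) (PathPoset.le_of_elem_le hc)
  · intro x hx
    obtain ⟨x, hx', rfl⟩ := Finset.mem_image.1 hx
    replace hx := hx'
    rw [PathPoset.isBot_iff, PathPoset.isTop_iff, hf x hx]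
    exact (MaxChain.mem_simplex.1 (hs hx)).2
  · refine Finset.image_image.trans ?_
    exact (Finset.image_congr hf).trans Finset.image_id

theorem skipLE_of_reflTransGen (hn : 2 ≤ n) {x y : NCPart (n + 1)}
    (h : Relation.ReflTransGen (PathEdge (parkingFunctionsUndesired n n)) x y) : SkipLE x y := by
  induction h with
  | refl => exact (skipOrder hn).le_refl _
  | tail _ h ih =>
    obtain ⟨c, hc, i, rfl, rfl⟩ := h
    exact ih.trans (MaxChain.skipLE_elem ((c.stanley_mem_iff hn).1 hc) Fin.castSucc_lt_succ.le)

/-- Path-connected pairs satisfy `SkipLE` by transitivity along the edges. Conversely, a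
`SkipLE`-chain lies on a single admissible maximal chain, whose path connects its members. -/
theorem mem_pathLink_iff (hn : 2 ≤ n) (s : Finset (NCPart (n + 1))) :
    s ∈ (pathLink (parkingFunctionsUndesired n n)).faces ↔
      s ∈ (@chainComplex _ (skipOrder hn) (skipProper n)).faces := by
  constructor
  · rintro ⟨s, ⟨hne, hch, hbt⟩, rfl⟩
    refine ⟨hne.image _, ?_, ?_⟩
    · intro x hx
      obtain ⟨x, hx', rfl⟩ := Finset.mem_image.1 (Finset.mem_coe.1 hx)
      replace hx := hx'
      have h := hbt x hx
      rw [PathPoset.isBot_iff, PathPoset.isTop_iff] at h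
      obtain ⟨y, c, hc, i, rfl⟩ := x
      have hc' := (c.stanley_mem_iff hn).1 hc
      refine ⟨h.1, h.2, ?_, ?_⟩
      · exact c.elem_zero ▸ MaxChain.skipLE_elem hc' (Fin.zero_le i)
      · exact c.elem_last ▸ MaxChain.skipLE_elem hc' (Fin.le_last i)
    · intro x hx y hy _
      obtain ⟨x, hx', rfl⟩ := Finset.mem_image.1 (Finset.mem_coe.1 hx)
      replace hx := hx'
      obtain ⟨y, hy', rfl⟩ := Finset.mem_image.1 (Finset.mem_coe.1 hy)
      replace hy := hy'
      exact (hch.total hx hy).imp (skipLE_of_reflTransGen hn) (skipLE_of_reflTransGen hn)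
  · rintro ⟨hne, hs, hch⟩
    obtain ⟨c, hc, hsub⟩ := MaxChain.exists_lastSkips_of_skipLE hn hs fun x hx y hy =>
      @IsChain.total _ _ _ _ _ ⟨(skipOrder hn).le_refl⟩ hch hx hy
    exact mem_pathLink_of_subset_simplex ((c.stanley_mem_iff hn).2 hc) hne hsub

theorem mem_pathLink_iff_subset_simplex (hn : 2 ≤ n) (s : Finset (NCPart (n + 1))) :
    s ∈ (pathLink (parkingFunctionsUndesired n n)).faces ↔
      s.Nonempty ∧ ∃ c : MaxChain n, c.stanley ∈ parkingFunctionsUndesired n n ∧ s ⊆ c.simplex := by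
  refine ⟨fun h => ?_, fun ⟨hne, c, hc, hs⟩ => mem_pathLink_of_subset_simplex hc hne hs⟩
  obtain ⟨hne, hs, hch⟩ := (mem_pathLink_iff hn s).1 h
  obtain ⟨c, hc, hsub⟩ := MaxChain.exists_lastSkips_of_skipLE hn hs fun x hx y hy =>
    @IsChain.total _ _ _ _ _ ⟨(skipOrder hn).le_refl⟩ hch hx hy
  exact ⟨hne, c, (c.stanley_mem_iff hn).2 hc, hsub⟩

end Link

end

theorem theorem4 (n : ℕ) (hn : 2 ≤ n) :
    pathLink (parkingFunctionsUndesired n n) ≤ posetLink (NCPart (n + 1)) ∧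
    (∀ s : Finset (NCPart (n + 1)), s ∈ (pathLink (parkingFunctionsUndesired n n)).faces ↔
      s.Nonempty ∧ ∃ c : MaxChain n, c.stanley ∈ parkingFunctionsUndesired n n ∧ s ⊆ c.simplex) ∧
    ContractibleSpace (geomRealization (pathLink (parkingFunctionsUndesired n n))) := by
  refine ⟨fun s hs => ?_, mem_pathLink_iff_subset_simplex hn, ?_⟩
  · obtain ⟨hne, c, -, hs⟩ := (mem_pathLink_iff_subset_simplex hn s).1 hs
    refine ⟨hne, fun x hx y hy _ => ?_, fun x hx => ?_⟩
    · obtain ⟨⟨i, rfl⟩, -⟩ := MaxChain.mem_simplex.1 (hs hx)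
      obtain ⟨⟨j, rfl⟩, -⟩ := MaxChain.mem_simplex.1 (hs hy)
      exact (le_total i j).imp (fun h => c.elem_mono h) fun h => c.elem_mono h
    · rw [isBot_iff_eq_bot, isTop_iff_eq_top]
      exact (MaxChain.mem_simplex.1 (hs hx)).2
  · rw [PreAbstractSimplicialComplex.ext_faces (mem_pathLink_iff hn)]
    exact NCPart.contractibleSpace_skipProper hn
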